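/- Let $s\ge1$, let $M$ be an irreducible $s\times s$ matrix with entries in $\{0,1\}$ (for all $i,j$ some power $M^n$, $n\ge1$, has a positive $(i,j)$ entry) and let $$\Sigma=\{x=(x_0,x_1,\dots)\in\{1,\dots,s\}^{\mathbb N} : M(x_j,x_{j+1})=1\ \ \forall j\ge 0\},\qquad \Sigma^*=\{y=(\dots,y_2,y_1) : M(y_{j+1},y_j)=1\ \ \forall j\ge1\},$$ $$\hat\Sigma=\{(y,x)\in\Sigma^*\times\Sigma : M(y_1,x_0)=1\},\qquad \pi(y,x)=x,\qquad \tau_y(x)=(y_1,x_0,x_1,\dots).$$ Fix $\lambda\in(0,1)$. The distance of two distinct sequences in $\Sigma$ is $\lambda^{k}$, where $k$ is the first index at which they differ; $\Sigma^*$ is metrized in the same way, and $\hat\Sigma$ by the maximum of the two distances. Let $\theta>0$ and let $A:\hat\Sigma\to\mathbb R$ be $\theta$-Hölder. A Borel probability measure $\mu$ on $\hat\Sigma$ is holonomic if $\int f(\tau_y(x))\,d\mu(y,x)=\int f(x)\,d\mu(y,x)$ for all $f\in C^0(\Sigma)$; $\bar A$ is the minimum of $\int A\,d\mu$ over holonomic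 probability measures. A continuous calibrated sub-action for $A$ is a continuous $u:\Sigma\to\mathbb R$ with $u(x)-u(\tau_y(x))\le A(y,x)-\bar A$ for all $(y,x)\in\hat\Sigma$ and $$u(x)=\min_{y:\,(y,x)\in\hat\Sigma}\big[u(\tau_y(x))+A(y,x)-\bar A\big]\qquad\forall x\in\Sigma.$$ For $\epsilon>0$, $x,x'\in\Sigma$ and $k\geq 1$, let $\mathcal P_k(x,x',\epsilon)$ be the set of sequences $(z^0,\dots,z^k)$ in $\hat\Sigma$, $z^i=(y^i,x^i)$, with $x^{i}=\tau_{y^{i+1}}(x^{i+1})$ for $0\le i<k$, $d(x^0,x)<\epsilon$ and $d(x^k,x')<\epsilon$. Let $\Omega(A)$ be the set of $x\in\Sigma$ such that for every $\epsilon>0$ there are $k\ge1$ and $(z^0,\dots,z^k)\in\mathcal P_k(x,x,\epsilon)$ with $\big|\sum_{i=1}^k(A-\bar A)(z^i)\big|<\epsilon$. The Peierls barrier $h_A:\Sigma\times\Sigma\to\mathbb R\cup\{+\infty\}$ is $$h_A(x,x')=\lim_{\epsilon\to0}\ \liminf_{k\to\infty}\ \inf\Big\{\sum_{i=1}^k(A-\bar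 A)(z^i) : (z^0,\dots,z^k)\in\mathcal P_k(x,x',\epsilon)\Big\}.$$ Then: 1. If $u$ is a continuous calibrated sub-action for $A$, then $u(x)=\min_{\bar x\in\Omega(A)}[u(\bar x)+h_A(\bar x,x)]$ for all $x\in\Sigma$. 2. Conversely, for every continuous $\phi:\Omega(A)\to\mathbb R$ with $\phi(x)-\phi(\bar x)\le h_A(\bar x,x)$ for all $x,\bar x\in\Omega(A)$, the function $u(x):=\min_{\bar x\in\Omega(A)}[\phi(\bar x)+h_A(\bar x,x)]$ is well defined (the minimum is attained and finite for every $x\in\Sigma$), it is a continuous calibrated sub-action for $A$, and $u=\phi$ on $\Omega(A)$. -/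

import Mathlib

open Filter Topology MeasureTheory

namespace Holonomic

variable {s : ℕ}

/-- The one-sided subshift of finite type with transition matrix `M`. It carries the topology and
the (Borel) σ-algebra induced by the product of the discrete alphabets. -/
abbrev Shift (M : Matrix (Fin s) (Fin s) ℤ) : Type :=
  {x : ℕ → Fin s // ∀ j, M (x j) (x (j + 1)) = 1}

/-- The dual subshift, whose points are the pasts `(…, y₃, y₂, y₁)`.
The letter `y_{j+1}` is stored as `y j`, so that `y₁` is `y 0`. -/
abbrev DualShift (M : Matrix (Fin s) (Fin s) ℤ) : Type :=
  {y : ℕ → Fin s // ∀ j, M (y (j + 1)) (y j) = 1}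

/-- The natural extension: the pairs `(y, x)` = `(…, y₂, y₁ | x₀, x₁, …)` with `M(y₁, x₀) = 1`. -/
abbrev NatExt (M : Matrix (Fin s) (Fin s) ℤ) : Type :=
  {z : DualShift M × Shift M // M (z.1.1 0) (z.2.1 0) = 1}

variable {M : Matrix (Fin s) (Fin s) ℤ}

/-- The σ-algebra used on the natural extension is its Borel σ-algebra. -/
theorem borelSpace_natExt (M : Matrix (Fin s) (Fin s) ℤ) : BorelSpace (NatExt M) := by
  have : SecondCountableTopology (Shift M) :=
    TopologicalSpace.Subtype.secondCountableTopology {x : ℕ → Fin s | ∀ j, M (x j) (x (j + 1)) = 1}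
  have : BorelSpace (DualShift M × Shift M) := Prod.borelSpace
  exact Subtype.borelSpace {z : DualShift M × Shift M | M (z.1.1 0) (z.2.1 0) = 1}

/-- The projection `π (y, x) = x`. -/
def proj (z : NatExt M) : Shift M := z.1.2

/-- The inverse branch `τ (y, x) = τ_y (x) = (y₁, x₀, x₁, …)`. -/
def tau (z : NatExt M) : Shift M :=
  ⟨fun n => Nat.casesOn n (z.1.1.1 0) (fun j => z.1.2.1 j), by
    intro j
    cases j with
    | zero => exact z.2
    | succ j => exact z.1.2.2 j⟩

/-- The distance `lam ^ min {j | x j ≠ x' j}` between sequences (and `0` if they are equal). -/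
noncomputable def seqDist (lam : ℝ) (x x' : ℕ → Fin s) : ℝ :=
  open Classical in if x = x' then 0 else lam ^ sInf {j | x j ≠ x' j}

/-- The maximum of the distances of the two components, on the natural extension. -/
noncomputable def extDist (lam : ℝ) (z z' : NatExt M) : ℝ :=
  max (seqDist lam z.1.1.1 z'.1.1.1) (seqDist lam z.1.2.1 z'.1.2.1)

/-- `A` is `θ`-Hölder on the natural extension. -/
def IsHolder (lam θ : ℝ) (A : NatExt M → ℝ) : Prop :=
  ∃ C : ℝ, ∀ z z' : NatExt M, |A z - A z'| ≤ C * extDist lam z z' ^ θ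

/-- Holonomic probability measures on the natural extension. -/
def IsHolonomic (μ : Measure (NatExt M)) : Prop :=
  IsProbabilityMeasure μ ∧
    ∀ f : C(Shift M, ℝ), ∫ z, f (tau z) ∂μ = ∫ z, f (proj z) ∂μ

/-- The holonomic minimizing value of `A`: the least integral of `A` against a holonomic
probability measure. -/
noncomputable def minValue (A : NatExt M → ℝ) : ℝ :=
  sInf {r : ℝ | ∃ μ : Measure (NatExt M), IsHolonomic μ ∧ r = ∫ z, A z ∂μ}

/-- `u` is a continuous sub-action with respect to `A`. -/
def IsSubAction (A : NatExt M → ℝ) (u : Shift M → ℝ) : Prop :=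
  Continuous u ∧ ∀ z : NatExt M, u (proj z) - u (tau z) ≤ A z - minValue A

/-- `u` is a continuous calibrated sub-action for `A`: moreover, for every `x`, the value `u x` is
the minimum of `u (τ_y x) + A (y, x) - minValue A` over all `y` with `(y, x)` in the natural
extension. -/
def IsCalibrated (A : NatExt M → ℝ) (u : Shift M → ℝ) : Prop :=
  IsSubAction A u ∧
    ∀ x : Shift M,
      IsLeast {r : ℝ | ∃ z : NatExt M, proj z = x ∧ r = u (tau z) + A z - minValue A} (u x)

/-- The paths `(z⁰, …, zᵏ)` of length `k` that begin within `ε` of `x` and end within `ε`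
of `x'`. -/
def Paths (lam ε : ℝ) (x x' : Shift M) (k : ℕ) : Set (Fin (k + 1) → NatExt M) :=
  {z | (∀ i : Fin k, proj (z i.castSucc) = tau (z i.succ)) ∧
    seqDist lam (proj (z 0)).1 x.1 < ε ∧ seqDist lam (proj (z (Fin.last k))).1 x'.1 < ε}

/-- The action `∑_{i = 1}^{k} (A - minValue A) (zⁱ)` of a path. -/
noncomputable def action (A : NatExt M → ℝ) {k : ℕ} (z : Fin (k + 1) → NatExt M) : ℝ :=
  ∑ i : Fin k, (A (z i.succ) - minValue A)

/-- The set `Ω(A)` of non-wandering points with respect to `A`. -/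
def Omega (lam : ℝ) (A : NatExt M → ℝ) : Set (Shift M) :=
  {x | ∀ ε : ℝ, 0 < ε → ∃ k : ℕ, 1 ≤ k ∧ ∃ z ∈ Paths lam ε x x k, |action A z| < ε}

/-- The infimum of the actions of the paths of length `k` from within `ε` of `x` to within `ε`
of `x'`; it is `+∞` if there is no such path. -/
noncomputable def minAction (lam : ℝ) (A : NatExt M → ℝ) (ε : ℝ) (x x' : Shift M) (k : ℕ) :
    EReal :=
  ⨅ z ∈ Paths lam ε x x' k, ((action A z : ℝ) : EReal)

/-- The Peierls barrier `h_A (x, x') = lim_{ε → 0} liminf_{k → ∞} S_A^ε (x, x', k)`. The inner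
quantity is monotone in `ε`, so the limit is a supremum; see `tendsto_peierls`. -/
noncomputable def peierls (lam : ℝ) (A : NatExt M → ℝ) (x x' : Shift M) : EReal :=
  ⨆ (ε : ℝ) (_ : 0 < ε), liminf (fun k : ℕ => minAction lam A ε x x' k) atTop

/-- The Peierls barrier is the limit as `ε` decreases to `0` of the lower limits over `k`. -/
theorem tendsto_peierls (lam : ℝ) (A : NatExt M → ℝ) (x x' : Shift M) :
    Tendsto (fun ε : ℝ => liminf (fun k : ℕ => minAction lam A ε x x' k) atTop) (𝓝[>] 0)
      (𝓝 (peierls lam A x x')) := by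
  have hanti : Antitone (fun ε : ℝ => liminf (fun k : ℕ => minAction lam A ε x x' k) atTop) := by
    intro ε ε' h
    refine liminf_le_liminf (Eventually.of_forall fun k => ?_)
    refine le_iInf₂ fun z hz => iInf₂_le z ?_
    exact ⟨hz.1, hz.2.1.trans_le h, hz.2.2.trans_le h⟩
  have := hanti.tendsto_nhdsGT 0
  rwa [sSup_image] at this

end Holonomic

/-! Put g = A - `minValue A`. A chain is an orbit segment of the shift, with a past chosen at each
step and the values of g summed; through `peierls_le_coe_iff` a real bound on the barrier becomes
the existence of long chains with nearly prescribed ends and action. The basic tool is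
`Chain.retarget`: keep the pasts and move the end within its first-letter cylinder. Inverse branches
contract, so the start hardly moves when the chain is long, and the change of action is a geometric
series of Hölder errors.

For a calibrated u, the sub-action inequality telescopes along chains, and continuity gives u(x) -
u(w) ≤ h(w, x). Following minimizing branches from x gives equality along chains; an accumulation
point of the points so visited lies in Ω and attains the minimum.

The converse needs two facts about actions. A closed chain carries a holonomic measure, so its
action is nonnegative; irreducibility closes any chain at bounded cost, so all actions are bounded
below (`exists_lower_bound`). In the other direction, integrating a Bellman inequality against an
almost minimizing holonomic measure gives chains of every length with action below 2, and the
pigeonhole principle extracts almost closed chains of almost zero action; hence Ω is nonempty. Since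
Ω is compact and the barrier from Ω is finite and lower semicontinuous in its source, the minimum
defining u is attained. Appending a step to a chain gives the sub-action inequality, removing the
last step gives calibration, and repeating a recurrent chain gives h(w, w) ≤ 0 on Ω, whence u = φ
there. -/

namespace Holonomic

/-! ### The ultrametric on sequences and the product topology. -/

section SeqDist

variable {s : ℕ} {lam : ℝ}

theorem seqDist_self (lam : ℝ) (x : ℕ → Fin s) : seqDist lam x x = 0 := by
  simp [seqDist]

theorem seqDist_comm (lam : ℝ) (x x' : ℕ → Fin s) : seqDist lam x x' = seqDist lam x' x := by
  by_cases h : x = x'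
  · rw [h]
  · simp only [seqDist, if_neg h, if_neg (Ne.symm h), ne_comm]

theorem seqDist_nonneg (h0 : 0 < lam) (x x' : ℕ → Fin s) : 0 ≤ seqDist lam x x' := by
  unfold seqDist
  split_ifs <;> positivity

theorem pow_le_seqDist (h0 : 0 < lam) (h1 : lam < 1) {x x' : ℕ → Fin s} {k : ℕ}
    (h : x k ≠ x' k) : lam ^ k ≤ seqDist lam x x' := by
  have hne : x ≠ x' := fun e => h (by rw [e])
  rw [seqDist, if_neg hne]
  exact pow_le_pow_of_le_one h0.le h1.le (Nat.sInf_le h)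

/-- The strict bound controls `k + 1` letters, whereas `≤` controls only `k`. The case `k = 0` is
used throughout: distance below 1 forces equal first letters. -/
theorem eq_of_seqDist_lt_pow (h0 : 0 < lam) (h1 : lam < 1) {x x' : ℕ → Fin s} {k j : ℕ}
    (h : seqDist lam x x' < lam ^ k) (hj : j ≤ k) : x j = x' j := by
  by_contra hne
  exact absurd (pow_le_seqDist h0 h1 hne)
    (not_le.2 (h.trans_le (pow_le_pow_of_le_one h0.le h1.le hj)))

theorem seqDist_le_pow_of_eq (h0 : 0 < lam) (h1 : lam < 1) {x x' : ℕ → Fin s} {n : ℕ}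
    (h : ∀ j < n, x j = x' j) : seqDist lam x x' ≤ lam ^ n := by
  unfold seqDist
  split_ifs with hxx
  · positivity
  · obtain ⟨k, hk⟩ := Function.ne_iff.1 hxx
    have hmem : sInf {j | x j ≠ x' j} ∈ {j | x j ≠ x' j} := Nat.sInf_mem ⟨k, hk⟩
    refine pow_le_pow_of_le_one h0.le h1.le ?_
    by_contra hlt
    exact hmem (h _ (not_le.1 hlt))

theorem seqDist_le_pow_iff (h0 : 0 < lam) (h1 : lam < 1) {x x' : ℕ → Fin s} {n : ℕ} :
    seqDist lam x x' ≤ lam ^ n ↔ ∀ j < n, x j = x' j := by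
  refine ⟨fun h j hj => ?_, seqDist_le_pow_of_eq h0 h1⟩
  refine eq_of_seqDist_lt_pow (k := j) h0 h1 (h.trans_lt ?_) le_rfl
  exact pow_lt_pow_right_of_lt_one₀ h0 h1 hj

theorem seqDist_le_one (h0 : 0 < lam) (h1 : lam < 1) (x x' : ℕ → Fin s) :
    seqDist lam x x' ≤ 1 := by
  simpa using seqDist_le_pow_of_eq (n := 0) h0 h1 (x := x) (x' := x') (by simp)

/-- At the first index where `x` and `z` differ, `y` differs from one of them. -/
theorem seqDist_ultra (h0 : 0 < lam) (h1 : lam < 1) (x y z : ℕ → Fin s) :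
    seqDist lam x z ≤ max (seqDist lam x y) (seqDist lam y z) := by
  by_cases hxz : x = z
  · rw [hxz, seqDist_self]
    exact le_max_of_le_left (seqDist_nonneg h0 _ _)
  · rw [show seqDist lam x z = lam ^ sInf {j | x j ≠ z j} by rw [seqDist, if_neg hxz]]
    obtain ⟨k, hk⟩ := Function.ne_iff.1 hxz
    have hmem : x (sInf {j | x j ≠ z j}) ≠ z (sInf {j | x j ≠ z j}) :=
      Nat.sInf_mem (s := {j | x j ≠ z j}) ⟨k, hk⟩
    by_cases hy : x (sInf {j | x j ≠ z j}) = y (sInf {j | x j ≠ z j})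
    · exact le_max_of_le_right (pow_le_seqDist h0 h1 (hy ▸ hmem))
    · exact le_max_of_le_left (pow_le_seqDist h0 h1 hy)

theorem seqDist_ultra_lt (h0 : 0 < lam) (h1 : lam < 1) {x y z : ℕ → Fin s} {ε : ℝ}
    (hxy : seqDist lam x y < ε) (hyz : seqDist lam y z < ε) : seqDist lam x z < ε :=
  (seqDist_ultra h0 h1 x y z).trans_lt (max_lt hxy hyz)

/-- Prepending a common letter multiplies the distance by `lam`. -/
theorem seqDist_eq_mul (x x' : ℕ → Fin s) (h : x 0 = x' 0) :
    seqDist lam x x' = lam * seqDist lam (fun j => x (j + 1)) (fun j => x' (j + 1)) := by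
  by_cases hxx : x = x'
  · subst hxx
    simp [seqDist_self]
  · have hs : (fun j => x (j + 1)) ≠ (fun j => x' (j + 1)) := by
      intro hs
      refine hxx (funext fun j => ?_)
      cases j with
      | zero => exact h
      | succ j => exact congrFun hs j
    obtain ⟨k, hk⟩ := Function.ne_iff.1 hs
    have hmem : sInf {j | x (j + 1) ≠ x' (j + 1)} ∈ {j | x (j + 1) ≠ x' (j + 1)} :=
      Nat.sInf_mem ⟨k, hk⟩
    rw [seqDist, if_neg hxx, seqDist, if_neg hs, ← pow_succ']
    congr 1
    refine IsLeast.csInf_eq ⟨hmem, fun j hj => ?_⟩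
    cases j with
    | zero => exact absurd h hj
    | succ j => exact Nat.succ_le_succ (Nat.sInf_le hj)

/-- The balls of `seqDist` form a basis of neighbourhoods for the product topology. -/
theorem hasBasis_nhds_seqDist (h0 : 0 < lam) (h1 : lam < 1) (x : ℕ → Fin s) :
    (𝓝 x).HasBasis (fun ε : ℝ => 0 < ε) (fun ε => {x' | seqDist lam x' x < ε}) := by
  refine ⟨fun t => ⟨fun ht => ?_, fun ⟨ε, hε, hsub⟩ => ?_⟩⟩
  · obtain ⟨u, ⟨y, n, rfl⟩, hx, hsub⟩ :=
      (PiNat.isTopologicalBasis_cylinders (fun _ : ℕ => Fin s)).mem_nhds_iff.1 ht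
    refine ⟨lam ^ n, by positivity, fun x' hx' => hsub ?_⟩
    rw [PiNat.mem_cylinder_iff] at hx ⊢
    intro i hi
    rw [eq_of_seqDist_lt_pow h0 h1 hx' hi.le, hx i hi]
  · obtain ⟨n, hn⟩ := exists_pow_lt_of_lt_one hε h1
    refine mem_of_superset ((PiNat.isOpen_cylinder (fun _ : ℕ => Fin s) x n).mem_nhds
      (PiNat.self_mem_cylinder x n)) fun x' hx' => hsub ?_
    exact (seqDist_le_pow_of_eq h0 h1 (PiNat.mem_cylinder_iff.1 hx')).trans_lt hn

end SeqDist

/-! ### Compactness of the shift spaces and contraction of the inverse branches. -/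

section Spaces

variable {s : ℕ} {M : Matrix (Fin s) (Fin s) ℤ} {lam : ℝ}

theorem hasBasis_nhds_shift (h0 : 0 < lam) (h1 : lam < 1) (x : Shift M) :
    (𝓝 x).HasBasis (fun ε : ℝ => 0 < ε) (fun ε => {x' | seqDist lam x'.1 x.1 < ε}) := by
  rw [nhds_subtype_eq_comap]
  exact (hasBasis_nhds_seqDist h0 h1 x.1).comap _

theorem eventually_seqDist_lt (h0 : 0 < lam) (h1 : lam < 1) (x : Shift M) {ε : ℝ} (hε : 0 < ε) :
    ∀ᶠ x' in 𝓝 x, seqDist lam x'.1 x.1 < ε :=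
  (hasBasis_nhds_shift h0 h1 x).mem_of_mem hε

theorem eventually_extDist_lt (h0 : 0 < lam) (h1 : lam < 1) (z : NatExt M) {ε : ℝ} (hε : 0 < ε) :
    ∀ᶠ z' in 𝓝 z, extDist lam z' z < ε := by
  have hy : Tendsto (fun z' : NatExt M => z'.1.1.1) (𝓝 z) (𝓝 z.1.1.1) :=
    Continuous.tendsto (by fun_prop) z
  have hx : Tendsto (fun z' : NatExt M => z'.1.2.1) (𝓝 z) (𝓝 z.1.2.1) :=
    Continuous.tendsto (by fun_prop) z
  filter_upwards [hy.eventually ((hasBasis_nhds_seqDist h0 h1 _).mem_of_mem hε),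
    hx.eventually ((hasBasis_nhds_seqDist h0 h1 _).mem_of_mem hε)] with z' h1 h2
  exact max_lt h1 h2

theorem extDist_nonneg (h0 : 0 < lam) (z z' : NatExt M) : 0 ≤ extDist lam z z' :=
  le_max_of_le_left (seqDist_nonneg h0 _ _)

instance compactSpace_shift : CompactSpace (Shift M) := by
  refine isCompact_iff_compactSpace.1 (IsClosed.isCompact (s := {x : ℕ → Fin s | _}) ?_)
  simp only [Set.ofPred_forall]
  refine isClosed_iInter fun j => ?_
  exact (isClosed_discrete {p : Fin s × Fin s | M p.1 p.2 = 1}).preimage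
    (f := fun x : ℕ → Fin s => (x j, x (j + 1))) (by fun_prop)

instance compactSpace_dualShift : CompactSpace (DualShift M) := by
  refine isCompact_iff_compactSpace.1 (IsClosed.isCompact (s := {x : ℕ → Fin s | _}) ?_)
  simp only [Set.ofPred_forall]
  refine isClosed_iInter fun j => ?_
  exact (isClosed_discrete {p : Fin s × Fin s | M p.1 p.2 = 1}).preimage
    (f := fun x : ℕ → Fin s => (x (j + 1), x j)) (by fun_prop)

instance compactSpace_natExt : CompactSpace (NatExt M) := by
  refine isCompact_iff_compactSpace.1 (IsClosed.isCompact
    (s := {z : DualShift M × Shift M | _}) ?_)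
  exact (isClosed_discrete {p : Fin s × Fin s | M p.1 p.2 = 1}).preimage
    (f := fun z : DualShift M × Shift M => (z.1.1 0, z.2.1 0))
    (((continuous_apply 0).comp (continuous_subtype_val.comp continuous_fst)).prodMk
      ((continuous_apply 0).comp (continuous_subtype_val.comp continuous_snd)))

theorem continuous_proj : Continuous (proj : NatExt M → Shift M) := by
  unfold proj
  fun_prop

theorem continuous_tau : Continuous (tau : NatExt M → Shift M) := by
  refine Continuous.subtype_mk (continuous_pi fun n => ?_) _
  cases n with
  | zero =>
    exact (continuous_apply 0).comp
      (continuous_subtype_val.comp (continuous_fst.comp continuous_subtype_val))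
  | succ n =>
    exact (continuous_apply n).comp
      (continuous_subtype_val.comp (continuous_snd.comp continuous_subtype_val))

/-- The point of the natural extension with the same past as `z` and with future `x`. -/
def withFuture (z : NatExt M) (x : Shift M) (h : x.1 0 = (proj z).1 0) : NatExt M :=
  ⟨(z.1.1, x), by have := z.2; rw [proj] at h; rwa [← h] at this⟩

/-- This contraction is the source of every geometric series below. -/
theorem seqDist_tau (z z' : NatExt M) (h : z.1.1 = z'.1.1) :
    seqDist lam (tau z).1 (tau z').1 = lam * seqDist lam (proj z).1 (proj z').1 := by
  refine seqDist_eq_mul _ _ ?_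
  change z.1.1.1 0 = z'.1.1.1 0
  rw [h]

theorem extDist_of_past_eq (h0 : 0 < lam) (z z' : NatExt M) (h : z.1.1 = z'.1.1) :
    extDist lam z z' = seqDist lam (proj z).1 (proj z').1 := by
  rw [extDist, h, seqDist_self]
  exact max_eq_right (seqDist_nonneg h0 _ _)

end Spaces

/-! ### Irreducibility and the existence of pasts. -/

section Irreducible

variable {s : ℕ} {M : Matrix (Fin s) (Fin s) ℤ}

theorem transGen_of_isIrreducible (hM01 : ∀ i j, M i j = 0 ∨ M i j = 1) (hM : M.IsIrreducible)
    (i j : Fin s) : Relation.TransGen (fun a b => M a b = 1) i j := by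
  let : Quiver (Fin s) := M.toQuiver
  have hedge : ∀ {a b : Fin s}, (a ⟶ b) → M a b = 1 := fun {a b} e =>
    (hM01 a b).resolve_left (ne_of_gt e.down)
  have key : ∀ {a b : Fin s} (p : Quiver.Path a b),
      p.length = 0 ∨ Relation.TransGen (fun a b => M a b = 1) a b := by
    intro a b p
    induction p with
    | nil => exact Or.inl rfl
    | cons p e ih =>
      right
      rcases ih with h | h
      · obtain rfl := Quiver.Path.eq_of_length_zero p h
        exact .single (hedge e)
      · exact h.tail (hedge e)
  obtain ⟨p, hp⟩ := hM.connected i j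
  exact (key p).resolve_left hp.ne'

theorem exists_predecessor (hM : ∀ i j : Fin s, Relation.TransGen (fun a b => M a b = 1) i j)
    (j : Fin s) : ∃ i, M i j = 1 := by
  obtain ⟨i, -, hi⟩ := Relation.TransGen.tail'_iff.1 (hM j j)
  exact ⟨i, hi⟩

/-- Every admissible letter can be prepended to a point by a point of the natural extension. -/
theorem exists_natExt (hM : ∀ i j : Fin s, Relation.TransGen (fun a b => M a b = 1) i j)
    (x : Shift M) {i : Fin s} (hi : M i (x.1 0) = 1) :
    ∃ z : NatExt M, proj z = x ∧ (tau z).1 0 = i := by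
  -- Iterating a choice of predecessor produces an admissible infinite past ending in `i`.
  choose g hg using exists_predecessor hM
  refine ⟨⟨(⟨fun n => g^[n] i, fun j => ?_⟩, x), hi⟩, rfl, rfl⟩
  change M (g^[j + 1] i) (g^[j] i) = 1
  rw [Function.iterate_succ_apply']
  exact hg _

theorem exists_proj_eq (hM : ∀ i j : Fin s, Relation.TransGen (fun a b => M a b = 1) i j)
    (x : Shift M) : ∃ z : NatExt M, proj z = x := by
  obtain ⟨i, hi⟩ := exists_predecessor hM (x.1 0)
  obtain ⟨z, hz, -⟩ := exists_natExt hM x hi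
  exact ⟨z, hz⟩

end Irreducible

end Holonomic
-- Chains and the translation of the barrier into chains.
namespace Holonomic

variable {s : ℕ} {M : Matrix (Fin s) (Fin s) ℤ} {lam : ℝ}

/-- `Chain g k p q a`: the point `q` is reached from `p` by a path of length `k` along which the
sum of `g` is `a`. -/
inductive Chain (g : NatExt M → ℝ) : ℕ → Shift M → Shift M → ℝ → Prop
  | nil (p : Shift M) : Chain g 0 p p 0
  | snoc {k : ℕ} {p : Shift M} {a : ℝ} (z : NatExt M) (h : Chain g k p (tau z) a) :
      Chain g (k + 1) p (proj z) (a + g z)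

namespace Chain

variable {g : NatExt M → ℝ}

theorem single (g : NatExt M → ℝ) (z : NatExt M) : Chain g 1 (tau z) (proj z) (g z) := by
  simpa using Chain.snoc z (Chain.nil (g := g) (tau z))

theorem trans {k l : ℕ} {p q r : Shift M} {a b : ℝ} (h : Chain g k p q a)
    (h' : Chain g l q r b) : Chain g (k + l) p r (a + b) := by
  induction h' with
  | nil => simpa using h
  | snoc z _ ih =>
    rw [← add_assoc a]
    exact Chain.snoc z (ih h)

/-- The end point of a chain is the shift of its first point. -/
theorem apply_eq {k : ℕ} {p q : Shift M} {a : ℝ} (h : Chain g k p q a) (j : ℕ) :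
    p.1 (k + j) = q.1 j := by
  induction h generalizing j with
  | nil => rw [zero_add]
  | @snoc k p a z _ ih =>
    have := ih (j + 1)
    rw [show k + 1 + j = k + (j + 1) by ring, this]
    rfl

/-- A chain can be made to end at any point sharing the first letter of its end point. -/
theorem retarget (h0 : 0 < lam) (h1 : lam < 1) {C θ : ℝ} (hC : 0 ≤ C) (hθ : 0 < θ)
    (hg : ∀ z z', |g z - g z'| ≤ C * extDist lam z z' ^ θ) {k : ℕ} {p q : Shift M} {a : ℝ}
    (h : Chain g k p q a) {q' : Shift M} (hq : q'.1 0 = q.1 0) :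
    ∃ p' a', Chain g k p' q' a' ∧ seqDist lam p'.1 p.1 ≤ lam ^ k * seqDist lam q'.1 q.1 ∧
      |a' - a| ≤ C / (1 - lam ^ θ) * seqDist lam q'.1 q.1 ^ θ := by
  have hlt : lam ^ θ < 1 := Real.rpow_lt_one h0.le h1 hθ
  induction h generalizing q' with
  | nil p =>
    have := Real.rpow_nonneg (seqDist_nonneg h0 q'.1 p.1) θ
    have := div_nonneg hC (sub_nonneg.2 hlt.le)
    exact ⟨q', 0, .nil q', by simp, by rw [sub_zero, abs_zero]; positivity⟩
  | @snoc k p a z hz ih =>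
    -- Keep the past of the last step and replace its future. Then `tau w` and `tau z` share their
    -- first letter, so the induction hypothesis applies at a distance smaller by the factor `lam`.
    set w := withFuture z q' hq with hw
    have hwp : proj w = q' := rfl
    obtain ⟨p', a', hc, hd, ha⟩ := ih (q' := tau w) rfl
    have hdt : seqDist lam (tau w).1 (tau z).1 = lam * seqDist lam q'.1 (proj z).1 :=
      seqDist_tau w z rfl
    refine ⟨p', a' + g w, .snoc w hc, ?_, ?_⟩
    · rw [pow_succ, mul_assoc, ← hdt]
      exact hd
    · have hgz := hg w z
      rw [extDist_of_past_eq h0 w z rfl, hwp] at hgz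
      rw [hdt, Real.mul_rpow h0.le (seqDist_nonneg h0 _ _)] at ha
      have hne : (1 - lam ^ θ) ≠ 0 := by linarith
      calc |a' + g w - (a + g z)| ≤ |a' - a| + |g w - g z| := by
            rw [show a' + g w - (a + g z) = (a' - a) + (g w - g z) by ring]
            exact abs_add_le _ _
        _ ≤ C / (1 - lam ^ θ) * (lam ^ θ * seqDist lam q'.1 (proj z).1 ^ θ)
            + C * seqDist lam q'.1 (proj z).1 ^ θ := add_le_add ha hgz
        -- The constant K = C / (1 - lam ^ θ) solves K * lam ^ θ + C = K.
        _ = _ := by field_simp; ring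

/-- The points and the partial sums along a chain. -/
theorem exists_seq {k : ℕ} {p q : Shift M} {a : ℝ} (h : Chain g k p q a) :
    ∃ (f : ℕ → Shift M) (b : ℕ → ℝ), f k = q ∧ b 0 = 0 ∧ b k = a ∧
      ∀ i j, i ≤ j → j ≤ k → Chain g (j - i) (f i) (f j) (b j - b i) := by
  induction h with
  | nil p =>
    refine ⟨fun _ => p, fun _ => 0, rfl, rfl, rfl, fun i j hij hj => ?_⟩
    obtain rfl : j = 0 := by omega
    obtain rfl : i = 0 := by omega
    simpa using Chain.nil p
  | @snoc k p a z hz ih =>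
    obtain ⟨f, b, hf, hb0, hb, hfb⟩ := ih
    refine ⟨Function.update f (k + 1) (proj z), Function.update b (k + 1) (a + g z),
      by simp, by simp [Function.update, hb0], by simp, fun i j hij hj => ?_⟩
    by_cases hjk : j = k + 1
    · subst hjk
      by_cases hik : i = k + 1
      · subst hik
        simpa using Chain.nil (g := g) (proj z)
      · have hi : i ≤ k := by omega
        have := hfb i k hi le_rfl
        rw [hf, hb] at this
        have := Chain.snoc z this
        rw [Function.update_self, Function.update_self, Function.update_of_ne hik,
          Function.update_of_ne hik, show k + 1 - i = k - i + 1 by omega]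
        convert this using 1
        ring
    · have hik : i ≠ k + 1 := by omega
      rw [Function.update_of_ne hik, Function.update_of_ne hik, Function.update_of_ne hjk,
        Function.update_of_ne hjk]
      exact hfb i j hij (by omega)

end Chain

/-- The chains are the paths of the natural extension, up to the choice of the initial past. -/
theorem chain_of_path {A : NatExt M → ℝ} {k : ℕ} (z : Fin (k + 1) → NatExt M)
    (h : ∀ i : Fin k, proj (z i.castSucc) = tau (z i.succ)) :
    Chain (fun z => A z - minValue A) k (proj (z 0)) (proj (z (Fin.last k))) (action A z) := by
  induction k with
  | zero => simpa [action] using Chain.nil (proj (z 0))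
  | succ k ih =>
    have hc := ih (fun i => z i.castSucc) fun i => h i.castSucc
    have hl := h (Fin.last k)
    rw [hl] at hc
    have ha : action A z =
        action A (fun i => z i.castSucc) + (A (z (Fin.last k).succ) - minValue A) :=
      Fin.sum_univ_castSucc _
    rw [ha]
    exact Chain.snoc _ hc

/-- The action omits the term of index 0, so any past may be attached to the starting point. -/
theorem exists_path_of_chain {A : NatExt M → ℝ}
    (hM : ∀ i j : Fin s, Relation.TransGen (fun a b => M a b = 1) i j)
    {k : ℕ} {p q : Shift M} {a : ℝ} (h : Chain (fun z => A z - minValue A) k p q a) :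
    ∃ z : Fin (k + 1) → NatExt M, (∀ i : Fin k, proj (z i.castSucc) = tau (z i.succ)) ∧
      proj (z 0) = p ∧ proj (z (Fin.last k)) = q ∧ action A z = a := by
  induction h with
  | nil p =>
    obtain ⟨z, hz⟩ := exists_proj_eq hM p
    exact ⟨fun _ => z, fun i => i.elim0, hz, hz, by simp [action]⟩
  | @snoc k p a w hw ih =>
    obtain ⟨z, hz, h0, hl, ha⟩ := ih
    refine ⟨Fin.snoc (α := fun _ => NatExt M) z w, fun i => ?_, ?_, ?_, ?_⟩
    · refine Fin.lastCases ?_ (fun i => ?_) i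
      · rw [Fin.succ_last, Fin.snoc_last, Fin.snoc_castSucc, hl]
      · rw [Fin.succ_castSucc, Fin.snoc_castSucc, Fin.snoc_castSucc]
        exact hz i
    · rw [← h0, ← Fin.castSucc_zero, Fin.snoc_castSucc]
    · rw [Fin.snoc_last]
    · rw [← ha, action, Fin.sum_univ_castSucc, action, Fin.succ_last, Fin.snoc_last]
      congr 1
      refine Finset.sum_congr rfl fun i _ => ?_
      rw [Fin.succ_castSucc, Fin.snoc_castSucc]

/-- There is a chain of length at least `N` and action less than `c + ε` from within `ε` of `w`
to within `ε` of `x`, for all `ε` and `N`. -/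
def Reaches (lam : ℝ) (g : NatExt M → ℝ) (w x : Shift M) (c : ℝ) : Prop :=
  ∀ ε : ℝ, 0 < ε → ∀ N : ℕ, ∃ k, N ≤ k ∧ ∃ p q a, Chain g k p q a ∧
    seqDist lam p.1 w.1 < ε ∧ seqDist lam q.1 x.1 < ε ∧ a < c + ε

theorem minAction_lt_iff {A : NatExt M → ℝ}
    (hM : ∀ i j : Fin s, Relation.TransGen (fun a b => M a b = 1) i j)
    {ε : ℝ} {w x : Shift M} {k : ℕ} {c : ℝ} :
    minAction lam A ε w x k < c ↔ ∃ p q a, Chain (fun z => A z - minValue A) k p q a ∧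
      seqDist lam p.1 w.1 < ε ∧ seqDist lam q.1 x.1 < ε ∧ a < c := by
  simp only [minAction, iInf_lt_iff, EReal.coe_lt_coe_iff, exists_prop]
  constructor
  · rintro ⟨z, ⟨hz, h0, hl⟩, hc⟩
    exact ⟨_, _, _, chain_of_path z hz, h0, hl, hc⟩
  · rintro ⟨p, q, a, h, h0, hl, hc⟩
    obtain ⟨z, hz, rfl, rfl, rfl⟩ := exists_path_of_chain hM h
    exact ⟨z, ⟨hz, h0, hl⟩, hc⟩

/-- Unfolds supremum, lower limit and infimum at once, so that later arguments handle only real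
numbers and chains. -/
theorem peierls_le_coe_iff {A : NatExt M → ℝ}
    (hM : ∀ i j : Fin s, Relation.TransGen (fun a b => M a b = 1) i j)
    {w x : Shift M} {c : ℝ} :
    peierls lam A w x ≤ c ↔ Reaches lam (fun z => A z - minValue A) w x c := by
  constructor
  · intro h ε hε N
    have hlim : liminf (fun k : ℕ => minAction lam A ε w x k) atTop < ((c + ε : ℝ) : EReal) := by
      refine lt_of_le_of_lt ?_ (EReal.coe_lt_coe_iff.2 (lt_add_of_pos_right c hε))
      exact (le_iSup₂_of_le (f := fun (ε : ℝ) (_ : 0 < ε) =>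
        liminf (fun k : ℕ => minAction lam A ε w x k) atTop) ε hε le_rfl).trans h
    obtain ⟨k, hk, hlt⟩ := (frequently_atTop.1 (frequently_lt_of_liminf_lt (h := hlim))) N
    exact ⟨k, hk, (minAction_lt_iff hM).1 hlt⟩
  · intro h
    refine iSup₂_le fun ε hε => ?_
    refine EReal.le_of_forall_lt_iff_le.1 fun d hd => ?_
    have hd : c < d := EReal.coe_lt_coe_iff.1 hd
    refine liminf_le_of_frequently_le (frequently_atTop.2 fun N => ?_)
    -- In `Reaches` one parameter is both the radius and the slack in the action; the minimum serves
    -- both.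
    obtain ⟨k, hk, p, q, a, hc, hp, hq, ha⟩ := h (min ε (d - c)) (lt_min hε (sub_pos.2 hd)) N
    refine ⟨k, hk, ((minAction_lt_iff hM).2 ⟨p, q, a, hc, hp.trans_le (min_le_left _ _),
      hq.trans_le (min_le_left _ _), ?_⟩).le⟩
    linarith [min_le_right ε (d - c)]

theorem mem_Omega_iff {A : NatExt M → ℝ}
    (hM : ∀ i j : Fin s, Relation.TransGen (fun a b => M a b = 1) i j) {x : Shift M} :
    x ∈ Omega lam A ↔ ∀ ε : ℝ, 0 < ε → ∃ k, 1 ≤ k ∧ ∃ p q a,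
      Chain (fun z => A z - minValue A) k p q a ∧
      seqDist lam p.1 x.1 < ε ∧ seqDist lam q.1 x.1 < ε ∧ |a| < ε := by
  refine forall₂_congr fun ε _ => exists_congr fun k => and_congr_right fun _ => ?_
  constructor
  · rintro ⟨z, ⟨hz, h0, hl⟩, hc⟩
    exact ⟨_, _, _, chain_of_path z hz, h0, hl, hc⟩
  · rintro ⟨p, q, a, h, h0, hl, hc⟩
    obtain ⟨z, hz, rfl, rfl, rfl⟩ := exists_path_of_chain hM h
    exact ⟨z, ⟨hz, h0, hl⟩, hc⟩

end Holonomic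
-- The representation of a calibrated sub-action.
namespace Holonomic

variable {s : ℕ} {M : Matrix (Fin s) (Fin s) ℤ} {lam : ℝ}

theorem coe_le_peierls {A : NatExt M → ℝ}
    (hM : ∀ i j : Fin s, Relation.TransGen (fun a b => M a b = 1) i j)
    {w x : Shift M} {d : ℝ}
    (h : ∀ c, Reaches lam (fun z => A z - minValue A) w x c → d ≤ c) :
    (d : EReal) ≤ peierls lam A w x := by
  refine EReal.le_of_forall_lt_iff_le.1 fun c hc => ?_
  exact EReal.coe_le_coe_iff.2 (h c ((peierls_le_coe_iff hM).1 hc.le))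

/-- The sub-action inequality telescopes. -/
theorem Chain.sub_le {g : NatExt M → ℝ} {u : Shift M → ℝ}
    (hu : ∀ z, u (proj z) - u (tau z) ≤ g z) {k : ℕ} {p q : Shift M} {a : ℝ}
    (h : Chain g k p q a) : u q - u p ≤ a := by
  induction h with
  | nil => simp
  | snoc z _ ih => linarith [hu z]

theorem Reaches.sub_le (h0 : 0 < lam) (h1 : lam < 1) {g : NatExt M → ℝ} {u : Shift M → ℝ}
    (hc : Continuous u) (hu : ∀ z, u (proj z) - u (tau z) ≤ g z) {w x : Shift M} {c : ℝ}
    (h : Reaches lam g w x c) : u x - u w ≤ c := by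
  refine le_of_forall_pos_le_add fun δ hδ => ?_
  obtain ⟨ε₁, hε₁, hw⟩ := (hasBasis_nhds_shift h0 h1 w).mem_iff.1
    (hc.continuousAt.eventually (gt_mem_nhds (show u w < u w + δ / 3 by linarith)))
  obtain ⟨ε₂, hε₂, hx⟩ := (hasBasis_nhds_shift h0 h1 x).mem_iff.1
    (hc.continuousAt.eventually (lt_mem_nhds (show u x - δ / 3 < u x by linarith)))
  obtain ⟨k, -, p, q, a, hch, hp, hq, ha⟩ :=
    h (min (δ / 3) (min ε₁ ε₂)) (by positivity) 0
  have h3 := hw (hp.trans_le ((min_le_right _ _).trans (min_le_left _ _)))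
  have h4 := hx (hq.trans_le ((min_le_right _ _).trans (min_le_right _ _)))
  simp only [Set.mem_ofPred_eq] at h3 h4
  linarith [hch.sub_le hu, min_le_left (δ / 3) (min ε₁ ε₂)]

theorem exists_mapClusterPt {X : Type*} [TopologicalSpace X] [CompactSpace X] (f : ℕ → X) :
    ∃ x, ∀ U ∈ 𝓝 x, ∀ N, ∃ n, N ≤ n ∧ f n ∈ U := by
  obtain ⟨x, hx⟩ := exists_clusterPt_of_compactSpace (map f atTop)
  exact ⟨x, fun U hU N => frequently_atTop.1 (mapClusterPt_iff_frequently.1 hx U hU) N⟩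

/-- Calibration produces, by compactness, a non-wandering point from which `x` is reached along
calibrated paths. -/
theorem IsCalibrated.exists_reaches (h0 : 0 < lam) (h1 : lam < 1) {A : NatExt M → ℝ}
    (hM : ∀ i j : Fin s, Relation.TransGen (fun a b => M a b = 1) i j)
    {u : Shift M → ℝ} (hu : IsCalibrated A u) (x : Shift M) :
    ∃ w ∈ Omega lam A, Reaches lam (fun z => A z - minValue A) w x (u x - u w) := by
  choose z hz hzu using fun x => (hu.2 x).1
  -- The backward orbit of `x` along minimizing branches. Each step is an equality, so the action
  -- between two of its points is exactly the difference of `u`.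
  set o : ℕ → Shift M := fun n => (fun x => tau (z x))^[n] x with ho
  have hstep : ∀ m, o (m + 1) = tau (z (o m)) := fun m =>
    Function.iterate_succ_apply' (fun x => tau (z x)) m x
  have hchain : ∀ m k, Chain (fun z => A z - minValue A) k (o (m + k)) (o m)
      (u (o m) - u (o (m + k))) := by
    intro m k
    induction k with
    | zero => simpa using Chain.nil (o m)
    | succ k ih =>
      have h1 := Chain.single (fun z => A z - minValue A) (z (o (m + k)))
      rw [hz, ← hstep] at h1
      have := h1.trans ih
      rw [add_comm k 1, show m + (1 + k) = m + k + 1 by ring]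
      convert this using 1
      have := hzu (o (m + k))
      rw [← hstep] at this
      linarith
  obtain ⟨w, hw⟩ := exists_mapClusterPt o
  have hnear : ∀ ε : ℝ, 0 < ε → ∀ N, ∃ n, N ≤ n ∧ seqDist lam (o n).1 w.1 < ε ∧
      |u (o n) - u w| < ε := by
    intro ε hε N
    exact hw _ (inter_mem (eventually_seqDist_lt h0 h1 w hε)
      (hu.1.1.continuousAt.eventually (eventually_abs_sub_lt (u w) hε))) N
  refine ⟨w, (mem_Omega_iff hM).2 fun ε hε => ?_, fun ε hε N => ?_⟩
  · obtain ⟨n, -, hn, hun⟩ := hnear (ε / 2) (by positivity) 0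
    -- Two distinct visits near `w` bound a chain of positive length whose action is small by
    -- continuity of `u`.
    obtain ⟨m, hm, hm', hum⟩ := hnear (ε / 2) (by positivity) (n + 1)
    obtain ⟨k, rfl⟩ := Nat.exists_eq_add_of_le hm
    refine ⟨1 + k, by omega, _, _, _, hchain n (1 + k), ?_, hn.trans (by linarith), ?_⟩
    · rw [← add_assoc]
      exact hm'.trans (by linarith)
    · rw [← add_assoc]
      rw [abs_lt] at *
      constructor <;> linarith
  · obtain ⟨n, hn, hd, hun⟩ := hnear ε hε N
    refine ⟨n, hn, _, _, _, hchain 0 n, ?_, ?_, ?_⟩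
    · rwa [zero_add]
    · change seqDist lam x.1 x.1 < ε
      rwa [seqDist_self]
    · rw [zero_add]
      change u x - u (o n) < _
      linarith [(abs_lt.1 hun).1]

theorem IsCalibrated.isLeast (h0 : 0 < lam) (h1 : lam < 1) {A : NatExt M → ℝ}
    (hM : ∀ i j : Fin s, Relation.TransGen (fun a b => M a b = 1) i j)
    {u : Shift M → ℝ} (hu : IsCalibrated A u) (x : Shift M) :
    IsLeast (Set.range fun w : Omega lam A => ((u w : ℝ) : EReal) + peierls lam A w x)
      ((u x : ℝ) : EReal) := by
  have hle : ∀ w : Shift M, ((u x - u w : ℝ) : EReal) ≤ peierls lam A w x := fun w =>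
    coe_le_peierls hM fun c hc => hc.sub_le h0 h1 hu.1.1 hu.1.2
  have hadd : ∀ w : Shift M, ((u x : ℝ) : EReal) = u w + ((u x - u w : ℝ) : EReal) := by
    intro w
    rw [← EReal.coe_add, add_sub_cancel]
  constructor
  · obtain ⟨w, hw, hr⟩ := hu.exists_reaches h0 h1 hM x
    refine ⟨⟨w, hw⟩, ?_⟩
    change ((u w : ℝ) : EReal) + peierls lam A w x = _
    rw [le_antisymm ((peierls_le_coe_iff hM).2 hr) (hle w), ← hadd]
  · rintro _ ⟨w, rfl⟩
    rw [hadd w]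
    exact add_le_add le_rfl (hle w)

end Holonomic
-- Hölder potentials, closed chains and holonomic measures.
namespace Holonomic

variable {s : ℕ} {M : Matrix (Fin s) (Fin s) ℤ} {lam θ C : ℝ}

/-- `g` is `θ`-Hölder with constant `C`, for admissible values of the parameters. -/
structure IsHolderWith (lam θ C : ℝ) (g : NatExt M → ℝ) : Prop where
  lam_pos : 0 < lam
  lam_lt_one : lam < 1
  exponent_pos : 0 < θ
  const_nonneg : 0 ≤ C
  abs_sub_le : ∀ z z', |g z - g z'| ≤ C * extDist lam z z' ^ θ

theorem IsHolder.exists_isHolderWith (h0 : 0 < lam) (h1 : lam < 1) (hθ : 0 < θ)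
    {A : NatExt M → ℝ} (hA : IsHolder lam θ A) (c : ℝ) :
    ∃ C, IsHolderWith lam θ C (fun z => A z - c) := by
  obtain ⟨C, hC⟩ := hA
  refine ⟨max C 0, h0, h1, hθ, le_max_right _ _, fun z z' => ?_⟩
  rw [sub_sub_sub_cancel_right]
  exact (hC z z').trans (mul_le_mul_of_nonneg_right (le_max_left _ _)
    (Real.rpow_nonneg (extDist_nonneg h0 z z') θ))

/-- The distortion constant of a Hölder function along chains. -/
noncomputable def distortion (lam θ C : ℝ) : ℝ := C / (1 - lam ^ θ)

/-- A bound inside first-letter cylinders suffices because these cylinders are open; this is the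
form of estimate that retargeting gives. -/
theorem continuous_of_abs_sub_le_seqDist (h0 : 0 < lam) (h1 : lam < 1) (hθ : 0 < θ) {K : ℝ}
    {v : Shift M → ℝ}
    (hv : ∀ x x' : Shift M, x'.1 0 = x.1 0 → |v x' - v x| ≤ K * seqDist lam x'.1 x.1 ^ θ) :
    Continuous v := by
  refine continuous_iff_continuousAt.2 fun x => ?_
  have hd : Tendsto (fun x' : Shift M => seqDist lam x'.1 x.1) (𝓝 x) (𝓝 0) := by
    refine tendsto_order.2 ⟨fun a ha => Eventually.of_forall fun x' =>
      ha.trans_le (seqDist_nonneg h0 _ _), fun a ha => eventually_seqDist_lt h0 h1 x ha⟩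
  have hK : Tendsto (fun x' : Shift M => K * seqDist lam x'.1 x.1 ^ θ) (𝓝 x) (𝓝 0) := by
    have := (hd.rpow_const (p := θ) (Or.inr hθ.le)).const_mul K
    rwa [Real.zero_rpow hθ.ne', mul_zero] at this
  refine tendsto_iff_norm_sub_tendsto_zero.2 (squeeze_zero' (Eventually.of_forall fun _ =>
    norm_nonneg _) ?_ hK)
  filter_upwards [eventually_seqDist_lt h0 h1 x one_pos] with x' hx'
  refine hv x x' (eq_of_seqDist_lt_pow (k := 0) h0 h1 ?_ le_rfl)
  rwa [pow_zero]

namespace IsHolderWith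

variable {g : NatExt M → ℝ}

theorem distortion_nonneg (hg : IsHolderWith lam θ C g) : 0 ≤ distortion lam θ C :=
  div_nonneg hg.const_nonneg
    (sub_nonneg.2 (Real.rpow_lt_one hg.lam_pos.le hg.lam_lt_one hg.exponent_pos).le)

theorem retarget (hg : IsHolderWith lam θ C g) {k : ℕ} {p q : Shift M} {a : ℝ}
    (h : Chain g k p q a) {q' : Shift M} (hq : q'.1 0 = q.1 0) :
    ∃ p' a', Chain g k p' q' a' ∧ seqDist lam p'.1 p.1 ≤ lam ^ k * seqDist lam q'.1 q.1 ∧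
      |a' - a| ≤ distortion lam θ C * seqDist lam q'.1 q.1 ^ θ :=
  h.retarget hg.lam_pos hg.lam_lt_one hg.const_nonneg hg.exponent_pos hg.abs_sub_le hq

theorem retarget_le (hg : IsHolderWith lam θ C g) {k : ℕ} {p q : Shift M} {a : ℝ}
    (h : Chain g k p q a) {q' : Shift M} (hq : q'.1 0 = q.1 0) :
    ∃ p' a', Chain g k p' q' a' ∧ seqDist lam p'.1 p.1 ≤ lam ^ k ∧
      |a' - a| ≤ distortion lam θ C := by
  obtain ⟨p', a', hc, hd, ha⟩ := hg.retarget h hq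
  have h1 := seqDist_le_one hg.lam_pos hg.lam_lt_one q'.1 q.1
  have h2 := seqDist_nonneg hg.lam_pos q'.1 q.1
  have h3 : (0 : ℝ) ≤ lam ^ k := pow_nonneg hg.lam_pos.le k
  exact ⟨p', a', hc, hd.trans (mul_le_of_le_one_right h3 h1),
    ha.trans (mul_le_of_le_one_right hg.distortion_nonneg
      (Real.rpow_le_one h2 h1 hg.exponent_pos.le))⟩

theorem continuous (hg : IsHolderWith lam θ C g) : Continuous g := by
  refine continuous_iff_continuousAt.2 fun z => ?_
  have hd : Tendsto (fun z' : NatExt M => extDist lam z' z) (𝓝 z) (𝓝 0) := by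
    refine tendsto_order.2 ⟨fun a ha => Eventually.of_forall fun z' =>
      ha.trans_le (extDist_nonneg hg.lam_pos _ _),
      fun a ha => eventually_extDist_lt hg.lam_pos hg.lam_lt_one z ha⟩
  have hK : Tendsto (fun z' : NatExt M => C * extDist lam z' z ^ θ) (𝓝 z) (𝓝 0) := by
    have := (hd.rpow_const (p := θ) (Or.inr hg.exponent_pos.le)).const_mul C
    rwa [Real.zero_rpow hg.exponent_pos.ne', mul_zero] at this
  exact tendsto_iff_norm_sub_tendsto_zero.2
    (squeeze_zero (fun _ => norm_nonneg _) (fun z' => hg.abs_sub_le z' z) hK)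

theorem exists_abs_le (hg : IsHolderWith lam θ C g) : ∃ G, 0 ≤ G ∧ ∀ z, |g z| ≤ G := by
  obtain ⟨G, hG⟩ := (isCompact_range hg.continuous).isBounded.exists_norm_le
  exact ⟨max G 0, le_max_right _ _, fun z => (hG _ ⟨z, rfl⟩).trans (le_max_left _ _)⟩

/-- Any letter is joined to any point by a chain of positive length and bounded action. -/
theorem exists_connection (hg : IsHolderWith lam θ C g)
    (hM : ∀ i j : Fin s, Relation.TransGen (fun a b => M a b = 1) i j) :
    ∃ D, 0 ≤ D ∧ ∀ (i : Fin s) (r : Shift M), ∃ n, 1 ≤ n ∧ ∃ p b, Chain g n p r b ∧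
      p.1 0 = i ∧ b ≤ D := by
  obtain ⟨G, -, hG⟩ := hg.exists_abs_le
  have hone : ∀ (i : Fin s) (r : Shift M), M i (r.1 0) = 1 →
      ∃ p b, Chain g 1 p r b ∧ p.1 0 = i ∧ b ≤ G := by
    intro i r hi
    obtain ⟨z, rfl, hz⟩ := exists_natExt hM r hi
    exact ⟨tau z, g z, Chain.single g z, hz, (le_abs_self _).trans (hG z)⟩
  have key : ∀ i j : Fin s, ∃ D, ∀ r : Shift M, r.1 0 = j → ∃ n, 1 ≤ n ∧ ∃ p b,
      Chain g n p r b ∧ p.1 0 = i ∧ b ≤ D := by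
    intro i j
    induction hM i j using Relation.TransGen.head_induction_on with
    | single h => exact ⟨G, fun r hr => ⟨1, le_rfl, hone _ r (hr ▸ h)⟩⟩
    | head h _ ih =>
      obtain ⟨D, hD⟩ := ih
      refine ⟨G + D, fun r hr => ?_⟩
      obtain ⟨n, -, p, b, hc, hp, hb⟩ := hD r hr
      obtain ⟨p', b', hc', hp', hb'⟩ := hone _ p (hp ▸ h)
      exact ⟨1 + n, by omega, p', b' + b, hc'.trans hc, hp', add_le_add hb' hb⟩
  choose D hD using key
  -- The alphabet is finite, so this sum bounds all the constants at once.
  refine ⟨∑ i, ∑ j, |D i j|, by positivity, fun i r => ?_⟩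
  obtain ⟨n, hn, p, b, hc, hp, hb⟩ := hD i (r.1 0) r rfl
  refine ⟨n, hn, p, b, hc, hp, hb.trans ((le_abs_self _).trans ?_)⟩
  exact (Finset.single_le_sum (f := fun j => |D i j|) (fun _ _ => abs_nonneg _)
    (Finset.mem_univ (r.1 0))).trans (Finset.single_le_sum (f := fun i => ∑ j, |D i j|)
      (fun _ _ => by positivity) (Finset.mem_univ i))

end IsHolderWith

/-- The periodic point that repeats the first `n` letters of `p`. -/
theorem exists_periodic (p : Shift M) {n : ℕ} (hn : 1 ≤ n) (hp : p.1 n = p.1 0) :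
    ∃ r : Shift M, (∀ j, r.1 (n + j) = r.1 j) ∧ ∀ j ≤ n, r.1 j = p.1 j := by
  refine ⟨⟨fun j => p.1 (j % n), fun j => ?_⟩, fun j => ?_, fun j hj => ?_⟩
  · change M (p.1 (j % n)) (p.1 ((j + 1) % n)) = 1
    have hlt := Nat.mod_lt j hn
    rcases Nat.lt_or_ge (j % n + 1) n with h | h
    · rw [show (j + 1) % n = j % n + 1 by rw [Nat.add_mod, Nat.mod_eq_of_lt (a := 1) (by omega),
        Nat.mod_eq_of_lt h]]
      exact p.2 _
    · have he : j % n + 1 = n := by omega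
      have h0 : (j + 1) % n = 0 := by
        rw [← Nat.mod_add_mod, he, Nat.mod_self]
      rw [h0, ← hp]
      have := p.2 (j % n)
      rwa [he] at this
  · change p.1 ((n + j) % n) = p.1 (j % n)
    rw [Nat.add_mod_left]
  · rcases hj.lt_or_eq with h | rfl
    · change p.1 (j % n) = _
      rw [Nat.mod_eq_of_lt h]
    · change p.1 (j % j) = _
      rw [Nat.mod_self, hp]

/-- Retarget the chain to the periodic point `r` repeating the first `k` letters of `p`. The new
start agrees with `p`, hence with `r`, on these letters, and its `k`-th shift is `r`; by periodicity
it is `r` itself. -/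
theorem IsHolderWith.exists_closed_chain {g : NatExt M → ℝ} (hg : IsHolderWith lam θ C g)
    {k : ℕ} (hk : 1 ≤ k) {p q : Shift M} {a : ℝ} (h : Chain g k p q a) (hpq : p.1 0 = q.1 0) :
    ∃ r a', Chain g k r r a' ∧ |a' - a| ≤ distortion lam θ C := by
  obtain ⟨r, hper, hr⟩ := exists_periodic p hk ((h.apply_eq 0).trans hpq.symm)
  obtain ⟨r', a', hc, hd, ha⟩ := hg.retarget_le h (q' := r)
    ((hr 0 (Nat.zero_le _)).trans hpq)
  have hrr : r' = r := by
    refine Subtype.ext (funext fun j => ?_)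
    rcases Nat.lt_or_ge j k with hj | hj
    · rw [(seqDist_le_pow_iff hg.lam_pos hg.lam_lt_one).1 hd j hj, hr j hj.le]
    · obtain ⟨i, rfl⟩ := Nat.exists_eq_add_of_le hj
      rw [hc.apply_eq, hper]
  exact ⟨r, a', hrr ▸ hc, ha⟩

instance (M : Matrix (Fin s) (Fin s) ℤ) : BorelSpace (NatExt M) := borelSpace_natExt M

theorem integrable_of_continuous {g : NatExt M → ℝ} (hg : Continuous g) (μ : Measure (NatExt M))
    [IsFiniteMeasure μ] : Integrable g μ :=
  hg.integrable_of_hasCompactSupport (HasCompactSupport.of_compactSpace g)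

/-- The sum of the Dirac masses along a chain. -/
theorem Chain.exists_measure {g : NatExt M → ℝ} (hg : Continuous g) {k : ℕ} {p q : Shift M}
    {a : ℝ} (h : Chain g k p q a) :
    ∃ μ : Measure (NatExt M), μ Set.univ = k ∧ ∫ z, g z ∂μ = a ∧
      ∀ f : C(Shift M, ℝ), ∫ z, f (proj z) ∂μ - ∫ z, f (tau z) ∂μ = f q - f p := by
  induction h with
  | nil p => exact ⟨0, by simp⟩
  | @snoc k p a z _ ih =>
    obtain ⟨μ, hμ, hμg, hf⟩ := ih
    have : IsFiniteMeasure μ := ⟨by rw [hμ]; exact ENNReal.natCast_lt_top k⟩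
    refine ⟨μ + Measure.dirac z, by simp [hμ], ?_, fun f => ?_⟩
    · rw [integral_add_measure (integrable_of_continuous hg _) (integrable_of_continuous hg _),
        integral_dirac, hμg]
    · have h1 : Continuous fun z : NatExt M => f (proj z) := f.continuous.comp continuous_proj
      have h2 : Continuous fun z : NatExt M => f (tau z) := f.continuous.comp continuous_tau
      rw [integral_add_measure (integrable_of_continuous h1 _) (integrable_of_continuous h1 _),
        integral_add_measure (integrable_of_continuous h2 _) (integrable_of_continuous h2 _),
        integral_dirac, integral_dirac]
      linarith [hf f]

/-- The normalized sum of Dirac masses is holonomic because the boundary term `f q - f p` vanishes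
on a closed chain. -/
theorem Chain.exists_isHolonomic {g : NatExt M → ℝ} (hg : Continuous g) {k : ℕ} (hk : 1 ≤ k)
    {r : Shift M} {a : ℝ} (h : Chain g k r r a) :
    ∃ μ : Measure (NatExt M), IsHolonomic μ ∧ ∫ z, g z ∂μ = a / k := by
  obtain ⟨μ, hμ, hμg, hf⟩ := h.exists_measure hg
  have hk0 : (k : ENNReal) ≠ 0 := by exact_mod_cast (by omega : k ≠ 0)
  refine ⟨(k : ENNReal)⁻¹ • μ, ⟨⟨?_⟩, fun f => ?_⟩, ?_⟩
  · rw [Measure.smul_apply, hμ, smul_eq_mul, ENNReal.inv_mul_cancel hk0 (ENNReal.natCast_ne_top k)]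
  · rw [integral_smul_measure, integral_smul_measure, sub_eq_zero.1 ((hf f).trans (sub_self _))]
  · rw [integral_smul_measure, hμg]
    simp [div_eq_inv_mul]

theorem bddBelow_holonomic {A : NatExt M → ℝ} (hA : Continuous A) :
    BddBelow {r : ℝ | ∃ μ : Measure (NatExt M), IsHolonomic μ ∧ r = ∫ z, A z ∂μ} := by
  obtain ⟨G, hG⟩ := (isCompact_range hA).isBounded.exists_norm_le
  refine ⟨-G, ?_⟩
  rintro _ ⟨μ, ⟨hμ, -⟩, rfl⟩
  have := norm_integral_le_of_norm_le_const (μ := μ) (f := A)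
    (Eventually.of_forall fun z => hG _ ⟨z, rfl⟩)
  rw [probReal_univ, mul_one] at this
  exact (abs_le.1 this).1

theorem continuous_of_sub_const {A : NatExt M → ℝ} {c : ℝ}
    (h : Continuous fun z => A z - c) : Continuous A := by
  simpa only [sub_add_cancel] using h.add_const c

theorem IsHolonomic.integral_sub {A : NatExt M → ℝ} (hA : Continuous A) (c : ℝ)
    {μ : Measure (NatExt M)} (hμ : IsHolonomic μ) :
    ∫ z, (A z - c) ∂μ = ∫ z, A z ∂μ - c := by
  have := hμ.1
  rw [MeasureTheory.integral_sub (integrable_of_continuous hA μ) (integrable_const c),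
    integral_const, probReal_univ, one_smul]

/-- The action of a closed chain is nonnegative, because it carries a holonomic measure. -/
theorem Chain.nonneg_of_closed {A : NatExt M → ℝ} (hA : Continuous A) {k : ℕ} {r : Shift M}
    {a : ℝ} (h : Chain (fun z => A z - minValue A) k r r a) : 0 ≤ a := by
  rcases Nat.eq_zero_or_pos k with rfl | hk
  · cases h
    rfl
  · obtain ⟨μ, hμ, hint⟩ := h.exists_isHolonomic (by fun_prop) hk
    rw [hμ.integral_sub hA] at hint
    have hle : minValue A ≤ ∫ z, A z ∂μ := csInf_le (bddBelow_holonomic hA) ⟨μ, hμ, rfl⟩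
    have hk' : (0 : ℝ) < k := by exact_mod_cast hk
    rw [eq_div_iff hk'.ne'] at hint
    rw [← hint]
    exact mul_nonneg (sub_nonneg.2 hle) hk'.le

/-- The actions of all chains are bounded below. -/
theorem IsHolderWith.exists_lower_bound {A : NatExt M → ℝ}
    (hg : IsHolderWith lam θ C (fun z => A z - minValue A))
    (hM : ∀ i j : Fin s, Relation.TransGen (fun a b => M a b = 1) i j) :
    ∃ L, 0 ≤ L ∧ ∀ {k : ℕ} {p q : Shift M} {a : ℝ},
      Chain (fun z => A z - minValue A) k p q a → -L ≤ a := by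
  have hA := continuous_of_sub_const hg.continuous
  obtain ⟨D, hD0, hD⟩ := hg.exists_connection hM
  have hK := hg.distortion_nonneg
  refine ⟨D + 2 * distortion lam θ C, by positivity, fun {k p q a} h => ?_⟩
  -- A connection leads from the last letter back to `p`. Retargeting the given chain to `q'` and
  -- then closing the concatenation cost one distortion each, whence D plus two distortions.
  obtain ⟨n, hn, q', b, hc, hq', hb⟩ := hD (q.1 0) p
  obtain ⟨p', a', hc', hd, ha'⟩ := hg.retarget h hq'
  have hp' : p'.1 0 = p.1 0 := by
    -- For `k = 0` the bound `lam ^ 0` controls no letter, but then the chains are trivial.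
    rcases Nat.eq_zero_or_pos k with rfl | hk
    · have h1 := hc'.apply_eq 0
      have h2 := h.apply_eq 0
      rw [zero_add] at h1 h2
      rw [h1, h2, hq']
    · refine (seqDist_le_pow_iff hg.lam_pos hg.lam_lt_one).1 (hd.trans ?_) 0 hk
      exact mul_le_of_le_one_right (pow_nonneg hg.lam_pos.le k)
        (seqDist_le_one hg.lam_pos hg.lam_lt_one _ _)
  have ha'' : |a' - a| ≤ distortion lam θ C := by
    refine ha'.trans (mul_le_of_le_one_right hK ?_)
    exact Real.rpow_le_one (seqDist_nonneg hg.lam_pos _ _)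
      (seqDist_le_one hg.lam_pos hg.lam_lt_one _ _) hg.exponent_pos.le
  obtain ⟨r, a₀, hr, ha₀⟩ := hg.exists_closed_chain (by omega) (hc'.trans hc) hp'
  have := hr.nonneg_of_closed hA
  linarith [(abs_le.1 ha'').2, (abs_le.1 ha₀).2]

/-- The set of holonomic integrals is nonempty. -/
theorem IsHolderWith.exists_holonomic {A : NatExt M → ℝ}
    (hg : IsHolderWith lam θ C (fun z => A z - minValue A))
    (hM : ∀ i j : Fin s, Relation.TransGen (fun a b => M a b = 1) i j) [hS : Nonempty (Shift M)] :
    ∃ μ : Measure (NatExt M), IsHolonomic μ := by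
  obtain ⟨D, -, hD⟩ := hg.exists_connection hM
  obtain ⟨x⟩ := hS
  obtain ⟨n, hn, p, b, hc, hp, -⟩ := hD (x.1 0) x
  obtain ⟨r, a, hr, -⟩ := hg.exists_closed_chain hn hc hp
  obtain ⟨μ, hμ, -⟩ := hr.exists_isHolonomic hg.continuous hn
  exact ⟨μ, hμ⟩

/-- The least action of the chains of length `k` that end at `x`. -/
noncomputable def leastAction (g : NatExt M → ℝ) (k : ℕ) (x : Shift M) : ℝ :=
  sInf {a | ∃ p, Chain g k p x a}

/-! ### The finite-horizon least action and chains of bounded action. -/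

section LeastAction

variable {g : NatExt M → ℝ}

theorem exists_chain (hM : ∀ i j : Fin s, Relation.TransGen (fun a b => M a b = 1) i j)
    (g : NatExt M → ℝ) (k : ℕ) (x : Shift M) : ∃ a p, Chain g k p x a := by
  induction k generalizing x with
  | zero => exact ⟨0, x, .nil x⟩
  | succ k ih =>
    obtain ⟨z, rfl⟩ := exists_proj_eq hM x
    obtain ⟨a, p, h⟩ := ih (tau z)
    exact ⟨_, p, .snoc z h⟩

theorem leastAction_zero (g : NatExt M → ℝ) (x : Shift M) : leastAction g 0 x = 0 := by
  have : {a | ∃ p, Chain g 0 p x a} = {0} := by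
    ext a
    constructor
    · rintro ⟨p, h⟩
      cases h
      rfl
    · rintro rfl
      exact ⟨x, .nil x⟩
  rw [leastAction, this, csInf_singleton]

variable {L : ℝ}

theorem leastAction_le (hL : ∀ {k : ℕ} {p q : Shift M} {a : ℝ}, Chain g k p q a → -L ≤ a)
    {k : ℕ} {p x : Shift M} {a : ℝ} (h : Chain g k p x a) : leastAction g k x ≤ a :=
  csInf_le ⟨-L, fun _ ⟨_, h⟩ => hL h⟩ ⟨p, h⟩

theorem le_leastAction (hM : ∀ i j : Fin s, Relation.TransGen (fun a b => M a b = 1) i j)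
    {k : ℕ} {x : Shift M} {c : ℝ} (h : ∀ p a, Chain g k p x a → c ≤ a) :
    c ≤ leastAction g k x :=
  le_csInf (exists_chain hM g k x) fun a ⟨p, hp⟩ => h p a hp

/-- The half of the Bellman equation that can be integrated against a measure. -/
theorem leastAction_succ_le (hL : ∀ {k : ℕ} {p q : Shift M} {a : ℝ}, Chain g k p q a → -L ≤ a)
    (hM : ∀ i j : Fin s, Relation.TransGen (fun a b => M a b = 1) i j)
    (k : ℕ) (z : NatExt M) :
    leastAction g (k + 1) (proj z) ≤ leastAction g k (tau z) + g z := by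
  rw [← sub_le_iff_le_add]
  refine le_leastAction hM fun p a h => ?_
  rw [sub_le_iff_le_add]
  exact leastAction_le hL (.snoc z h)

theorem IsHolderWith.continuous_leastAction (hg : IsHolderWith lam θ C g)
    (hL : ∀ {k : ℕ} {p q : Shift M} {a : ℝ}, Chain g k p q a → -L ≤ a)
    (hM : ∀ i j : Fin s, Relation.TransGen (fun a b => M a b = 1) i j) (k : ℕ) :
    Continuous (leastAction g k) := by
  have key : ∀ x x' : Shift M, x'.1 0 = x.1 0 →
      leastAction g k x' - distortion lam θ C * seqDist lam x'.1 x.1 ^ θ ≤ leastAction g k x := by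
    intro x x' hx
    refine le_leastAction hM fun p a h => ?_
    obtain ⟨p', a', h', -, ha⟩ := hg.retarget h hx
    linarith [(abs_le.1 ha).2, leastAction_le hL h']
  refine continuous_of_abs_sub_le_seqDist hg.lam_pos hg.lam_lt_one hg.exponent_pos
    (K := distortion lam θ C) fun x x' hx => abs_le.2 ⟨?_, ?_⟩
  · have := key x' x hx.symm
    rw [seqDist_comm] at this
    linarith
  · linarith [key x x' hx]

/-- Integrate the Bellman inequality; holonomy, applied to the continuous function `leastAction g
k`, replaces `tau` by `proj`, and each step adds one integral of `g`. -/
theorem IsHolderWith.integral_leastAction_le (hg : IsHolderWith lam θ C g)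
    (hL : ∀ {k : ℕ} {p q : Shift M} {a : ℝ}, Chain g k p q a → -L ≤ a)
    (hM : ∀ i j : Fin s, Relation.TransGen (fun a b => M a b = 1) i j)
    {μ : Measure (NatExt M)} (hμ : IsHolonomic μ) (k : ℕ) :
    ∫ z, leastAction g k (proj z) ∂μ ≤ k * ∫ z, g z ∂μ := by
  have := hμ.1
  have hc := hg.continuous_leastAction hL hM
  induction k with
  | zero => simp [leastAction_zero]
  | succ k ih =>
    have hi := integrable_of_continuous ((hc (k + 1)).comp continuous_proj) μ
    have hi' := integrable_of_continuous ((hc k).comp continuous_tau) μ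
    have hig := integrable_of_continuous hg.continuous μ
    have h1 := integral_mono hi (hi'.add hig) fun z => leastAction_succ_le hL hM k z
    have h2 : ∫ z, ((leastAction g k ∘ tau) + g) z ∂μ =
        ∫ z, leastAction g k (tau z) ∂μ + ∫ z, g z ∂μ := integral_add hi' hig
    have h3 := hμ.2 ⟨leastAction g k, hc k⟩
    simp only [ContinuousMap.coe_mk] at h3
    simp only [Function.comp_apply] at h1
    rw [h2, h3] at h1
    push_cast
    linarith

end LeastAction

/-- There are chains of every length whose actions are bounded above. -/
theorem IsHolderWith.exists_chain_lt_two {A : NatExt M → ℝ}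
    (hg : IsHolderWith lam θ C (fun z => A z - minValue A))
    (hM : ∀ i j : Fin s, Relation.TransGen (fun a b => M a b = 1) i j) [Nonempty (Shift M)]
    (k : ℕ) : ∃ p q a, Chain (fun z => A z - minValue A) k p q a ∧ a < 2 := by
  have hA := continuous_of_sub_const hg.continuous
  obtain ⟨L, -, hL⟩ := hg.exists_lower_bound hM
  obtain ⟨μ₀, hμ₀⟩ := hg.exists_holonomic hM
  -- A tolerance `1 / (k + 1)` keeps the total excess over `k` steps at most 1, so no minimizing
  -- measure is needed.
  obtain ⟨_, ⟨μ, hμ, rfl⟩, hlt⟩ := exists_lt_of_csInf_lt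
    (s := {r : ℝ | ∃ μ : Measure (NatExt M), IsHolonomic μ ∧ r = ∫ z, A z ∂μ})
    (b := minValue A + 1 / (k + 1)) ⟨_, μ₀, hμ₀, rfl⟩
    (lt_add_of_pos_right (minValue A) (by positivity))
  have hint := hg.integral_leastAction_le hL hM hμ k
  rw [hμ.integral_sub hA] at hint
  have := hμ.1
  have hk : (k : ℝ) * (∫ z, A z ∂μ - minValue A) ≤ 1 := by
    calc (k : ℝ) * (∫ z, A z ∂μ - minValue A) ≤ k * (1 / (k + 1)) := by gcongr; linarith
      _ ≤ 1 := by rw [mul_one_div, div_le_one (by positivity)]; linarith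
  -- Somewhere the least action is at most its mean, hence at most 1; raising the bound to 2 leaves
  -- room to select an actual chain.
  obtain ⟨z, hz⟩ := exists_le_integral (integrable_of_continuous
    ((hg.continuous_leastAction hL hM k).comp continuous_proj) μ)
  have hz' : leastAction (fun z => A z - minValue A) k (proj z) < 2 :=
    lt_of_le_of_lt (hz.trans (hint.trans hk)) one_lt_two
  obtain ⟨a, ⟨p, hp⟩, ha⟩ := exists_lt_of_csInf_lt (exists_chain hM _ k (proj z)) hz'
  exact ⟨p, _, a, hp, ha⟩

end Holonomic
-- Non-wandering points and the regularity of the barrier.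
namespace Holonomic

variable {s : ℕ} {M : Matrix (Fin s) (Fin s) ℤ} {lam θ C : ℝ}

theorem exists_pos_lt_of_exponent_pos {θ ε : ℝ} (hθ : 0 < θ) (hε : 0 < ε) (m n : ℝ) :
    ∃ η : ℝ, 0 < η ∧ η < 1 ∧ η < ε ∧ m * η + n * η ^ θ < ε := by
  have hlim : Tendsto (fun η : ℝ => m * η + n * η ^ θ) (𝓝[>] 0) (𝓝 0) := by
    have h1 : Tendsto (fun η : ℝ => η ^ θ) (𝓝 0) (𝓝 0) := by
      have := (tendsto_id (α := ℝ) (x := 𝓝 0)).rpow_const (p := θ) (Or.inr hθ.le)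
      rwa [Real.zero_rpow hθ.ne'] at this
    have h2 := ((tendsto_id (α := ℝ) (x := 𝓝 0)).const_mul m).add (h1.const_mul n)
    simp only [mul_zero, add_zero] at h2
    exact h2.mono_left nhdsWithin_le_nhds
  have hlt : ∀ᶠ η : ℝ in 𝓝[>] 0, η < min ε 1 :=
    (gt_mem_nhds (lt_min hε one_pos)).filter_mono nhdsWithin_le_nhds
  obtain ⟨η, ⟨hη, hη1⟩, hη0⟩ :=
    (((hlim.eventually (gt_mem_nhds hε)).and hlt).and self_mem_nhdsWithin).exists
  exact ⟨η, hη0, hη1.trans_le (min_le_right _ _), hη1.trans_le (min_le_left _ _), hη⟩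

namespace IsHolderWith

variable {A : NatExt M → ℝ}

/-- By the pigeonhole principle there are almost closed chains of almost zero action. -/
theorem exists_almost_closed_chain (hg : IsHolderWith lam θ C (fun z => A z - minValue A))
    (hM : ∀ i j : Fin s, Relation.TransGen (fun a b => M a b = 1) i j) [Nonempty (Shift M)]
    {ε : ℝ} (hε : 0 < ε) :
    ∃ k, 1 ≤ k ∧ ∃ p q a, Chain (fun z => A z - minValue A) k p q a ∧
      seqDist lam p.1 q.1 < ε ∧ |a| < ε := by
  obtain ⟨L, hL0, hL⟩ := hg.exists_lower_bound hM
  obtain ⟨N, hN⟩ := exists_pow_lt_of_lt_one hε hg.lam_lt_one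
  -- Pigeonholes: the first `N` letters, and the partial sum up to width `ε`. Partial sums lie
  -- between `-L` and `2 + L`, because both the initial part and the remaining part have action at
  -- least `-L`.
  set T : Finset ((Fin N → Fin s) × ℤ) :=
    Finset.univ ×ˢ Finset.Icc ⌊-L / ε⌋ ⌊(2 + L) / ε⌋ with hT
  obtain ⟨p, q, a, hc, ha⟩ := hg.exists_chain_lt_two hM T.card
  obtain ⟨f, b, -, hb0, hbk, hfb⟩ := hc.exists_seq
  have hmaps : ∀ i ∈ Finset.range (T.card + 1),
      ((fun j : Fin N => (f i).1 j, ⌊b i / ε⌋) : (Fin N → Fin s) × ℤ) ∈ T := by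
    intro i hi
    have hi : i ≤ T.card := Nat.lt_succ_iff.1 (Finset.mem_range.1 hi)
    have hl := hL (hfb 0 i (Nat.zero_le _) hi)
    have hr := hL (hfb i _ hi le_rfl)
    simp only [hT, Finset.mem_product, Finset.mem_univ, true_and, Finset.mem_Icc]
    constructor <;> refine Int.floor_mono (div_le_div_of_nonneg_right ?_ hε.le) <;> linarith
  have hpig := Finset.exists_ne_map_eq_of_card_lt_of_maps_to (by simp) hmaps
  obtain ⟨i, j, hj, hij, he⟩ : ∃ i j, j ∈ Finset.range (T.card + 1) ∧ i < j ∧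
      ((fun n : Fin N => (f i).1 n, ⌊b i / ε⌋) : (Fin N → Fin s) × ℤ) =
        (fun n : Fin N => (f j).1 n, ⌊b j / ε⌋) := by
    obtain ⟨i, hi, j, hj, hne, he⟩ := hpig
    rcases lt_or_gt_of_ne hne with h | h
    · exact ⟨i, j, hj, h, he⟩
    · exact ⟨j, i, hi, h, he.symm⟩
  rw [Prod.mk.injEq] at he
  refine ⟨j - i, by omega, _, _, _,
    hfb i j hij.le (Nat.lt_succ_iff.1 (Finset.mem_range.1 hj)), ?_, ?_⟩
  · refine (seqDist_le_pow_of_eq hg.lam_pos hg.lam_lt_one (n := N) fun n hn => ?_).trans_lt hN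
    exact congrFun he.1 ⟨n, hn⟩
  · have := Int.abs_sub_lt_one_of_floor_eq_floor he.2.symm
    rwa [← sub_div, abs_div, abs_of_pos hε, div_lt_one hε] at this

/-- Starting points of ever more nearly closed chains accumulate, and any accumulation point is
non-wandering. -/
theorem omega_nonempty (hg : IsHolderWith lam θ C (fun z => A z - minValue A))
    (hM : ∀ i j : Fin s, Relation.TransGen (fun a b => M a b = 1) i j) [Nonempty (Shift M)] :
    (Omega lam A).Nonempty := by
  choose k hk p q a hc hd ha using fun n : ℕ =>
    hg.exists_almost_closed_chain hM (Nat.one_div_pos_of_nat (α := ℝ) (n := n))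
  obtain ⟨w, hw⟩ := exists_mapClusterPt p
  refine ⟨w, (mem_Omega_iff hM).2 fun ε hε => ?_⟩
  obtain ⟨N, hN⟩ := exists_nat_one_div_lt hε
  obtain ⟨n, hn, hpw⟩ := hw _ (eventually_seqDist_lt hg.lam_pos hg.lam_lt_one w hε) N
  have hnε : (1 : ℝ) / (n + 1) < ε := (Nat.one_div_le_one_div hn).trans_lt hN
  refine ⟨k n, hk n, _, _, _, hc n, hpw, ?_, (ha n).trans hnε⟩
  refine seqDist_ultra_lt hg.lam_pos hg.lam_lt_one ?_ hpw
  rw [seqDist_comm]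
  exact (hd n).trans hnε

/-- Each copy is retargeted to end at the start of the chain already built. By the ultrametric
inequality the starts never leave the `η`-ball, so only the action errors add up, linearly. -/
theorem repeat_chain {g : NatExt M → ℝ} (hg : IsHolderWith lam θ C g) {k : ℕ} {p q : Shift M}
    {a η : ℝ} (h : Chain g k p q a) (hη : η ≤ 1) (hpq : seqDist lam p.1 q.1 < η) (n : ℕ) :
    ∃ r b, Chain g ((n + 1) * k) r q b ∧ seqDist lam r.1 p.1 < η ∧
      b ≤ (n + 1) * a + n * (distortion lam θ C * η ^ θ) := by
  have hη0 : 0 < η := (seqDist_nonneg hg.lam_pos _ _).trans_lt hpq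
  induction n with
  | zero => exact ⟨p, a, by simpa using h, by rwa [seqDist_self], by simp⟩
  | succ n ih =>
    obtain ⟨r, b, hc, hd, hb⟩ := ih
    have hrq : seqDist lam r.1 q.1 < η :=
      seqDist_ultra_lt hg.lam_pos hg.lam_lt_one hd hpq
    have hrq0 : r.1 0 = q.1 0 := eq_of_seqDist_lt_pow (k := 0) hg.lam_pos hg.lam_lt_one
      (by rw [pow_zero]; exact hrq.trans_le hη) le_rfl
    obtain ⟨r', a', hc', hd', ha'⟩ := hg.retarget h hrq0
    refine ⟨r', a' + b, ?_, hd'.trans_lt ?_, ?_⟩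
    · rw [show (n + 1 + 1) * k = k + (n + 1) * k by ring]
      exact hc'.trans hc
    · exact (mul_le_of_le_one_left (seqDist_nonneg hg.lam_pos _ _)
        (pow_le_one₀ hg.lam_pos.le hg.lam_lt_one.le)).trans_lt hrq
    · have := (abs_le.1 ha').2
      have h2 : distortion lam θ C * seqDist lam r.1 q.1 ^ θ ≤ distortion lam θ C * η ^ θ :=
        mul_le_mul_of_nonneg_left (Real.rpow_le_rpow (seqDist_nonneg hg.lam_pos _ _) hrq.le
          hg.exponent_pos.le) hg.distortion_nonneg
      push_cast
      linarith

/-- Recurrence provides chains of length at least 1 only, while the barrier wants arbitrarily long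
ones: repeat a recurrent chain `N + 1` times, at a scale `η` chosen after `N` to absorb the
accumulated error. -/
theorem reaches_self (hg : IsHolderWith lam θ C (fun z => A z - minValue A))
    (hM : ∀ i j : Fin s, Relation.TransGen (fun a b => M a b = 1) i j) {w : Shift M}
    (hw : w ∈ Omega lam A) : Reaches lam (fun z => A z - minValue A) w w 0 := by
  intro ε hε N
  obtain ⟨η, hη0, hη1, hηε, hη⟩ := exists_pos_lt_of_exponent_pos hg.exponent_pos hε ((N : ℝ) + 1)
    (N * distortion lam θ C)
  obtain ⟨k, hk, p, q, a, hc, hp, hq, ha⟩ := (mem_Omega_iff hM).1 hw η hη0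
  have hpq : seqDist lam p.1 q.1 < η :=
    seqDist_ultra_lt hg.lam_pos hg.lam_lt_one hp (by rwa [seqDist_comm])
  obtain ⟨r, b, hr, hrp, hb⟩ := hg.repeat_chain hc hη1.le hpq N
  refine ⟨(N + 1) * k, by nlinarith, r, q, b, hr,
    (seqDist_ultra_lt hg.lam_pos hg.lam_lt_one hrp hp).trans hηε, hq.trans hηε, ?_⟩
  have : ((N : ℝ) + 1) * a ≤ (N + 1) * η :=
    mul_le_mul_of_nonneg_left ((le_abs_self a).trans ha.le) (by positivity)
  linarith

/-- The chains in the definition of `Reaches` can be taken to end exactly at the target. -/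
theorem exists_chain_of_reaches {g : NatExt M → ℝ} (hg : IsHolderWith lam θ C g) {w x : Shift M}
    {c : ℝ} (h : Reaches lam g w x c) {ε : ℝ} (hε : 0 < ε) (N : ℕ) :
    ∃ k, N ≤ k ∧ ∃ p a, Chain g k p x a ∧ seqDist lam p.1 w.1 < ε ∧ a < c + ε := by
  obtain ⟨η, hη0, hη1, hηε, hη⟩ := exists_pos_lt_of_exponent_pos hg.exponent_pos hε 1
    (distortion lam θ C)
  obtain ⟨k, hk, p, q, a, hc, hp, hq, ha⟩ := h η hη0 N
  rw [seqDist_comm] at hq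
  obtain ⟨p', a', hc', hd, ha'⟩ := hg.retarget hc (q' := x)
    (eq_of_seqDist_lt_pow (k := 0) hg.lam_pos hg.lam_lt_one
      (by rw [pow_zero]; exact hq.trans hη1) le_rfl)
  refine ⟨k, hk, p', a', hc', ?_, ?_⟩
  · refine (seqDist_ultra_lt hg.lam_pos hg.lam_lt_one (hd.trans_lt ?_) hp).trans hηε
    exact (mul_le_of_le_one_left (seqDist_nonneg hg.lam_pos _ _)
      (pow_le_one₀ hg.lam_pos.le hg.lam_lt_one.le)).trans_lt hq
  · have h2 : distortion lam θ C * seqDist lam x.1 q.1 ^ θ ≤ distortion lam θ C * η ^ θ :=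
      mul_le_mul_of_nonneg_left (Real.rpow_le_rpow (seqDist_nonneg hg.lam_pos _ _) hq.le
        hg.exponent_pos.le) hg.distortion_nonneg
    linarith [(abs_le.1 ha').2]

theorem reaches_of_exact {g : NatExt M → ℝ} {w x : Shift M} {c : ℝ}
    (h : ∀ ε : ℝ, 0 < ε → ∀ N : ℕ, ∃ k, N ≤ k ∧ ∃ p a, Chain g k p x a ∧
      seqDist lam p.1 w.1 < ε ∧ a < c + ε) : Reaches lam g w x c := by
  intro ε hε N
  obtain ⟨k, hk, p, a, hc, hp, ha⟩ := h ε hε N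
  exact ⟨k, hk, p, x, a, hc, hp, by rwa [seqDist_self], ha⟩

/-- Changing the target within a cylinder changes the barrier in a Hölder way. -/
theorem reaches_of_apply_zero_eq {g : NatExt M → ℝ} (hg : IsHolderWith lam θ C g)
    {w x x' : Shift M} {c : ℝ} (h : Reaches lam g w x c) (hx : x'.1 0 = x.1 0) :
    Reaches lam g w x' (c + distortion lam θ C * seqDist lam x'.1 x.1 ^ θ) := by
  refine reaches_of_exact fun ε hε N => ?_
  -- `x'` need not be near `x`; length at least `m` alone keeps the new start near `w`.
  obtain ⟨m, hm⟩ := exists_pow_lt_of_lt_one hε hg.lam_lt_one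
  obtain ⟨k, hk, p, a, hc, hp, ha⟩ := hg.exists_chain_of_reaches h hε (max N m)
  obtain ⟨p', a', hc', hd, ha'⟩ := hg.retarget hc hx
  refine ⟨k, (le_max_left _ _).trans hk, p', a', hc', ?_, by linarith [(abs_le.1 ha').2]⟩
  refine seqDist_ultra_lt hg.lam_pos hg.lam_lt_one (hd.trans_lt ?_) hp
  refine lt_of_le_of_lt (mul_le_of_le_one_right (pow_nonneg hg.lam_pos.le k)
    (seqDist_le_one hg.lam_pos hg.lam_lt_one _ _)) (lt_of_le_of_lt ?_ hm)
  exact pow_le_pow_of_le_one hg.lam_pos.le hg.lam_lt_one.le ((le_max_right _ _).trans hk)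

theorem reaches_trans_chain {g : NatExt M → ℝ} (hg : IsHolderWith lam θ C g) {w q r : Shift M}
    {b c : ℝ} {n : ℕ} (h : Reaches lam g w q c) (hc : Chain g n q r b) :
    Reaches lam g w r (c + b) := by
  refine reaches_of_exact fun ε hε N => ?_
  obtain ⟨k, hk, p, a, hp, hd, ha⟩ := hg.exists_chain_of_reaches h hε N
  exact ⟨k + n, by omega, p, a + b, hp.trans hc, hd, by linarith⟩

/-- Every point is reached from every non-wandering point. -/
theorem exists_reaches (hg : IsHolderWith lam θ C (fun z => A z - minValue A))
    (hM : ∀ i j : Fin s, Relation.TransGen (fun a b => M a b = 1) i j) {w : Shift M}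
    (hw : w ∈ Omega lam A) (x : Shift M) :
    ∃ c, Reaches lam (fun z => A z - minValue A) w x c := by
  obtain ⟨D, -, hD⟩ := hg.exists_connection hM
  obtain ⟨n, -, q, b, hc, hq, -⟩ := hD (w.1 0) x
  exact ⟨_, hg.reaches_trans_chain
    (hg.reaches_of_apply_zero_eq (hg.reaches_self hM hw) hq) hc⟩

/-- The last step of the chains towards `x` can be removed, along a limit of these steps. -/
theorem exists_reaches_tau {g : NatExt M → ℝ} (hg : IsHolderWith lam θ C g) {w x : Shift M}
    {c : ℝ} (h : Reaches lam g w x c) :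
    ∃ z : NatExt M, proj z = x ∧ Reaches lam g w (tau z) (c - g z) := by
  have hlast : ∀ n : ℕ, ∃ z : NatExt M, proj z = x ∧ ∃ k, n ≤ k ∧ ∃ p a,
      Chain g k p (tau z) a ∧ seqDist lam p.1 w.1 < 1 / ((n : ℝ) + 1) ∧
      a + g z < c + 1 / ((n : ℝ) + 1) := by
    intro n
    obtain ⟨k, hk, p, a, hc, hp, ha⟩ :=
      -- Length at least `n + 1` guarantees a last step and leaves at least `n` steps before it.
      hg.exists_chain_of_reaches h (Nat.one_div_pos_of_nat (α := ℝ) (n := n)) (n + 1)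
    cases hc with
    | nil => omega
    | snoc z hz => exact ⟨z, rfl, _, by omega, _, _, hz, hp, ha⟩
  choose z hz k hk p a hc hp ha using hlast
  obtain ⟨y, hy⟩ := exists_mapClusterPt z
  have hyx : proj y = x := by
    by_contra hne
    obtain ⟨n, -, hn⟩ := hy _ (continuous_proj.continuousAt.eventually_ne hne) 0
    exact hn (hz n)
  refine ⟨y, hyx, fun ε hε N => ?_⟩
  obtain ⟨m, hm⟩ := exists_nat_one_div_lt (half_pos hε)
  obtain ⟨n, hn, ht, hgn⟩ := hy _ (inter_mem
    (continuous_tau.continuousAt.eventually (eventually_seqDist_lt hg.lam_pos hg.lam_lt_one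
      (tau y) hε))
    (hg.continuous.continuousAt.eventually (lt_mem_nhds (show g y - ε / 2 < g y by linarith))))
    (max N m)
  have hnε : (1 : ℝ) / (n + 1) < ε / 2 :=
    (Nat.one_div_le_one_div ((le_max_right _ _).trans hn)).trans_lt hm
  have hgn : g y - ε / 2 < g (z n) := hgn
  exact ⟨k n, (le_max_left _ _).trans (hn.trans (hk n)), p n, _, a n, hc n,
    (hp n).trans (by linarith), ht, by linarith [ha n]⟩

end IsHolderWith

/-- Starts are prescribed only up to `ε`, so sources may be perturbed; this is lower semicontinuity
of the barrier in its source. -/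
theorem Reaches.of_frequently (h0 : 0 < lam) (h1 : lam < 1) {g : NatExt M → ℝ} {w x : Shift M}
    {c : ℝ} (h : ∀ ε : ℝ, 0 < ε → ∃ w' : Shift M, seqDist lam w'.1 w.1 < ε ∧
      Reaches lam g w' x (c + ε)) : Reaches lam g w x c := by
  intro ε hε N
  obtain ⟨w', hw', hr⟩ := h (ε / 2) (half_pos hε)
  obtain ⟨k, hk, p, q, a, hc, hp, hq, ha⟩ := hr (ε / 2) (half_pos hε) N
  exact ⟨k, hk, p, q, a, hc, (seqDist_ultra_lt h0 h1 hp hw').trans (half_lt_self hε),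
    hq.trans (half_lt_self hε), by linarith⟩

theorem isClosed_Omega (h0 : 0 < lam) (h1 : lam < 1) {A : NatExt M → ℝ}
    (hM : ∀ i j : Fin s, Relation.TransGen (fun a b => M a b = 1) i j) :
    IsClosed (Omega lam A) := by
  refine isClosed_of_closure_subset fun w hw => (mem_Omega_iff hM).2 fun ε hε => ?_
  obtain ⟨w', hd, hw'⟩ := mem_closure_iff_nhds.1 hw _ (eventually_seqDist_lt h0 h1 w hε)
  obtain ⟨k, hk, p, q, a, hc, hp, hq, ha⟩ := (mem_Omega_iff hM).1 hw' ε hε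
  exact ⟨k, hk, p, q, a, hc, seqDist_ultra_lt h0 h1 hp hd, seqDist_ultra_lt h0 h1 hq hd, ha⟩

theorem coe_add_le_coe_iff (r y : ℝ) (h : EReal) :
    (r : EReal) + h ≤ y ↔ h ≤ ((y - r : ℝ) : EReal) := by
  induction h with
  | bot => simp
  | top => simp [-EReal.coe_sub]
  | coe h =>
    rw [← EReal.coe_add, EReal.coe_le_coe_iff, EReal.coe_le_coe_iff, le_sub_iff_add_le']

/-- The function minimized in the representation formula is lower semicontinuous. -/
theorem lowerSemicontinuous_add_peierls (h0 : 0 < lam) (h1 : lam < 1) {A : NatExt M → ℝ}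
    (hM : ∀ i j : Fin s, Relation.TransGen (fun a b => M a b = 1) i j)
    {φ : Omega lam A → ℝ} (hφ : Continuous φ) (x : Shift M)
    (hbot : ∀ w : Omega lam A, peierls lam A w x ≠ ⊥) :
    LowerSemicontinuous fun w : Omega lam A => ((φ w : ℝ) : EReal) + peierls lam A w x := by
  refine lowerSemicontinuous_iff_isClosed_preimage.2 fun y => ?_
  induction y with
  | bot =>
    convert isClosed_empty
    refine Set.eq_empty_of_forall_notMem fun w hw => ?_
    rcases EReal.add_eq_bot_iff.1 (le_bot_iff.1 hw) with h | h
    · exact EReal.coe_ne_bot _ h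
    · exact hbot w h
  | top => simp
  | coe y =>
    refine isClosed_of_closure_subset fun w hw => ?_
    change (φ w : EReal) + peierls lam A w x ≤ y
    rw [coe_add_le_coe_iff, peierls_le_coe_iff hM]
    refine Reaches.of_frequently h0 h1 fun ε hε => ?_
    obtain ⟨w', ⟨hd, hlt⟩, hw'⟩ := mem_closure_iff_nhds.1 hw _ (inter_mem
      (continuous_subtype_val.continuousAt.eventually (eventually_seqDist_lt h0 h1 w.1 hε))
      (hφ.continuousAt.eventually (lt_mem_nhds (show φ w - ε < φ w by linarith))))
    refine ⟨w', hd, ?_⟩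
    have hlt : φ w - ε < φ w' := hlt
    have hle : (φ w' : EReal) + peierls lam A w' x ≤ y := hw'
    rw [coe_add_le_coe_iff] at hle
    refine (peierls_le_coe_iff hM).1 (hle.trans (EReal.coe_le_coe_iff.2 ?_))
    linarith

end Holonomic
-- The converse: sub-actions built from data on the non-wandering set.
namespace Holonomic

variable {s : ℕ} {M : Matrix (Fin s) (Fin s) ℤ} {lam θ C : ℝ}

namespace IsHolderWith

variable {A : NatExt M → ℝ}

theorem peierls_ne_bot (hg : IsHolderWith lam θ C (fun z => A z - minValue A))
    (hM : ∀ i j : Fin s, Relation.TransGen (fun a b => M a b = 1) i j) (w x : Shift M) :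
    peierls lam A w x ≠ ⊥ := by
  obtain ⟨L, -, hL⟩ := hg.exists_lower_bound hM
  refine ne_bot_of_le_ne_bot (EReal.coe_ne_bot (-L - 1)) (coe_le_peierls hM fun c hc => ?_)
  obtain ⟨k, -, p, q, a, hch, -, -, ha⟩ := hc 1 one_pos 0
  linarith [hL hch]

/-- A lower semicontinuous function attains its minimum on the nonempty compact set Ω. The value is
finite: actions are bounded below, and every point is reached from Ω. -/
theorem exists_isLeast (hg : IsHolderWith lam θ C (fun z => A z - minValue A))
    (hM : ∀ i j : Fin s, Relation.TransGen (fun a b => M a b = 1) i j)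
    {φ : Omega lam A → ℝ} (hφ : Continuous φ) (x : Shift M) :
    ∃ r : ℝ, IsLeast (Set.range fun w : Omega lam A =>
      ((φ w : ℝ) : EReal) + peierls lam A w x) (r : EReal) := by
  have : Nonempty (Shift M) := ⟨x⟩
  have hne := hg.omega_nonempty hM
  have : CompactSpace (Omega lam A) := isCompact_iff_compactSpace.1
    (isClosed_Omega hg.lam_pos hg.lam_lt_one hM).isCompact
  have : Nonempty (Omega lam A) := hne.to_subtype
  obtain ⟨w, -, hw⟩ := LowerSemicontinuousOn.exists_isMinOn Set.univ_nonempty isCompact_univ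
    ((lowerSemicontinuous_add_peierls hg.lam_pos hg.lam_lt_one hM hφ x
      fun w => hg.peierls_ne_bot hM w x).lowerSemicontinuousOn Set.univ)
  obtain ⟨c, hc⟩ := hg.exists_reaches hM w.2 x
  have htop : peierls lam A w x ≠ ⊤ :=
    ne_top_of_le_ne_top (EReal.coe_ne_top c) ((peierls_le_coe_iff hM).2 hc)
  lift peierls lam A w x to ℝ using ⟨htop, hg.peierls_ne_bot hM w x⟩ with h hh
  refine ⟨φ w + h, ⟨w, ?_⟩, ?_⟩
  · change ((φ w : ℝ) : EReal) + peierls lam A w x = _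
    rw [← hh, EReal.coe_add]
  · rintro _ ⟨w', rfl⟩
    rw [EReal.coe_add, hh]
    exact hw (Set.mem_univ w')

/-- A function given by the representation formula is a continuous calibrated sub-action. -/
theorem isCalibrated_of_isLeast (hg : IsHolderWith lam θ C (fun z => A z - minValue A))
    (hM : ∀ i j : Fin s, Relation.TransGen (fun a b => M a b = 1) i j)
    {φ : Omega lam A → ℝ} {u : Shift M → ℝ}
    (hu : ∀ x : Shift M, IsLeast (Set.range fun w : Omega lam A =>
      ((φ w : ℝ) : EReal) + peierls lam A w x) ((u x : ℝ) : EReal)) : IsCalibrated A u := by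
  have hle : ∀ (w : Omega lam A) (x : Shift M) (c : ℝ),
      Reaches lam (fun z => A z - minValue A) w x c → u x ≤ φ w + c := by
    intro w x c hc
    have h := (hu x).2 ⟨w, rfl⟩
    rw [← EReal.coe_le_coe_iff, EReal.coe_add]
    exact h.trans (add_le_add le_rfl ((peierls_le_coe_iff hM).2 hc))
  have hex : ∀ x, ∃ w : Omega lam A,
      Reaches lam (fun z => A z - minValue A) w x (u x - φ w) := by
    intro x
    obtain ⟨w, hw⟩ := (hu x).1
    exact ⟨w, (peierls_le_coe_iff hM).1 ((coe_add_le_coe_iff _ _ _).1 hw.le)⟩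
  have hsub : ∀ z, u (proj z) - u (tau z) ≤ A z - minValue A := by
    intro z
    obtain ⟨w, hw⟩ := hex (tau z)
    have := hle w _ _ (hg.reaches_trans_chain hw (Chain.single (fun z => A z - minValue A) z))
    linarith
  -- The minimizer for `x` competes at `x'` in the same cylinder, and the Hölder bound on the
  -- barrier does not depend on the source.
  have hcont : Continuous u := by
    have key : ∀ x x' : Shift M, x'.1 0 = x.1 0 →
        u x' ≤ u x + distortion lam θ C * seqDist lam x'.1 x.1 ^ θ := by
      intro x x' hx
      obtain ⟨w, hw⟩ := hex x
      linarith [hle w _ _ (hg.reaches_of_apply_zero_eq hw hx)]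
    refine continuous_of_abs_sub_le_seqDist hg.lam_pos hg.lam_lt_one hg.exponent_pos
      (K := distortion lam θ C) fun x x' hx => abs_le.2 ⟨?_, ?_⟩
    · have := key x' x hx.symm
      rw [seqDist_comm] at this
      linarith
    · linarith [key x x' hx]
  refine ⟨⟨hcont, hsub⟩, fun x => ⟨?_, ?_⟩⟩
  · obtain ⟨w, hw⟩ := hex x
    -- Removing the last step of near-optimal chains gives the inequality opposite to `hsub`, hence
    -- calibration at `z`.
    obtain ⟨z, rfl, hz⟩ := hg.exists_reaches_tau hw
    exact ⟨z, rfl, by linarith [hle w _ _ hz, hsub z]⟩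
  · rintro _ ⟨z, rfl, rfl⟩
    linarith [hsub z]

/-- The bound `u ≤ φ` takes the point itself as source and uses `reaches_self`; the bound `φ ≤ u` is
the compatibility condition applied at a minimizing source. -/
theorem eq_on_omega_of_isLeast (hg : IsHolderWith lam θ C (fun z => A z - minValue A))
    (hM : ∀ i j : Fin s, Relation.TransGen (fun a b => M a b = 1) i j)
    {φ : Omega lam A → ℝ}
    (hφ : ∀ x w : Omega lam A, ((φ x - φ w : ℝ) : EReal) ≤ peierls lam A w x)
    {u : Shift M → ℝ}
    (hu : ∀ x : Shift M, IsLeast (Set.range fun w : Omega lam A =>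
      ((φ w : ℝ) : EReal) + peierls lam A w x) ((u x : ℝ) : EReal)) (x : Omega lam A) :
    u x = φ x := by
  refine le_antisymm ?_ ?_
  · rw [← EReal.coe_le_coe_iff]
    refine ((hu x).2 ⟨x, rfl⟩).trans ((coe_add_le_coe_iff _ _ _).2 ?_)
    rw [sub_self]
    exact (peierls_le_coe_iff hM).2 (hg.reaches_self hM x.2)
  · obtain ⟨w, hw⟩ := (hu x).1
    have h := (hφ x w).trans ((coe_add_le_coe_iff _ _ _).1 hw.le)
    linarith [EReal.coe_le_coe_iff.1 h]

end IsHolderWith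

end Holonomic

theorem theorem3p5 {s : ℕ} (M : Matrix (Fin s) (Fin s) ℤ)
    (hM01 : ∀ i j, M i j = 0 ∨ M i j = 1) (hM : M.IsIrreducible)
    (lam θ : ℝ) (hlam0 : 0 < lam) (hlam1 : lam < 1) (hθ : 0 < θ)
    (A : Holonomic.NatExt M → ℝ) (hA : Holonomic.IsHolder lam θ A) :
    (∀ u : Holonomic.Shift M → ℝ, Holonomic.IsCalibrated A u →
      ∀ x : Holonomic.Shift M,
        IsLeast (Set.range fun w : Holonomic.Omega lam A =>
          ((u w : ℝ) : EReal) + Holonomic.peierls lam A w x) ((u x : ℝ) : EReal)) ∧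
    (∀ φ : Holonomic.Omega lam A → ℝ, Continuous φ →
      (∀ x w : Holonomic.Omega lam A,
        ((φ x - φ w : ℝ) : EReal) ≤ Holonomic.peierls lam A w x) →
      ∃ u : Holonomic.Shift M → ℝ,
        (∀ x : Holonomic.Shift M,
          IsLeast (Set.range fun w : Holonomic.Omega lam A =>
            ((φ w : ℝ) : EReal) + Holonomic.peierls lam A w x) ((u x : ℝ) : EReal)) ∧
        Holonomic.IsCalibrated A u ∧
        ∀ w : Holonomic.Omega lam A, u w = φ w) := by
  have hT := Holonomic.transGen_of_isIrreducible hM01 hM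
  obtain ⟨C, hg⟩ := hA.exists_isHolderWith hlam0 hlam1 hθ (Holonomic.minValue A)
  refine ⟨fun u hu x => hu.isLeast hlam0 hlam1 hT x, fun φ hφ hφh => ?_⟩
  choose u hu using hg.exists_isLeast hT hφ
  exact ⟨u, hu, hg.isCalibrated_of_isLeast hT hu, hg.eq_on_omega_of_isLeast hT hφh hu⟩
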